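/- Let $K,d,n,L$ be integers with $n\ge 1$ and $d\ge K$, and suppose that either $L=2$ and $K\ge 6$, or $L\ge 3$ and $K\ge 4$. For parameters $\Theta=(W_L,W_{L-1},\dots,W_1,H_1)$ with $W_L\in\mathbb R^{K\times d}$, $W_{L-1},\dots,W_1\in\mathbb R^{d\times d}$, $H_1\in\mathbb R^{d\times nK}$, let $Z(\Theta)=W_L\cdots W_1H_1\in\mathbb R^{K\times nK}$, with columns $z_{ic}$ ($1\le c\le K$, $1\le i\le n$) ordered by class $c$, and consider the hard-margin problem $$\min_\Theta\ E(\Theta)=\|H_1\|_F^2+\sum_{l=1}^L\|W_l\|_F^2\quad\text{subject to}\quad (z_{ic})_c-(z_{ic})_{c'}\ge 1\ \text{ for all } i \text{ and all } c\ne c'.$$ Put $W_0=H_1$, $\hat X=X/\|X\|_F$ and $S=I_K-\frac1K 1_K1_K^T$. Call $\Theta$ a DNC (deep neural collapse) configuration if $\hat W_l^T\hat W_l=\hat W_{l-1}\hat W_{l-1}^T$ for $l=1,\dots,L$ and $\hat W_L\cdots\hat W_1\hat W_0$ is a positive multiple of $S\otimes 1_n^T$. Call $\Theta$ a DNC solution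 if it is a feasible DNC configuration whose objective $E(\Theta)$ is least among all feasible DNC configurations (that is, a DNC configuration at its best scaling). Then: 1. DNC solutions exist. 2. Every DNC solution $\Theta$ satisfies $Z(\Theta)=S\otimes 1_n^T$ and is a local minimum of the problem; the local minimum is strict up to the set of DNC solutions: every feasible $\Theta'$ sufficiently close to $\Theta$ that is not itself a DNC solution (in particular, every such $\Theta'$ with $Z(\Theta')\neq S\otimes 1_n^T$) has $E(\Theta')>E(\Theta)$. 3. DNC is not globally optimal: the problem has a global minimizer $\Theta_0$, and $E(\Theta_0)<E(\Theta)$ for every feasible DNC configuration $\Theta$. In particular the problem has several distinct locally optimal structures. -/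

import Mathlib

open scoped Matrix Topology

namespace DeepUFM

/-- Parameters `(W_L, (W_1, …, W_{L-1}), H_1)` of the deep unconstrained features model with
`K` classes, `n` samples per class, width `d` and `m = L - 1` square hidden layers (`W_{j+1}` is
the `j`-th entry of the second component).  The columns of `H_1` are indexed by pairs `(c, i)`,
standing for sample `i` of class `c`.  The type carries the usual (product) topology. -/
abbrev Params (K d n m : ℕ) : Type :=
  Matrix (Fin K) (Fin d) ℝ × (Fin m → Matrix (Fin d) (Fin d) ℝ) ×
    Matrix (Fin d) (Fin K × Fin n) ℝ

variable {K d n m : ℕ}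

/-- The last-layer matrix `W_L`. -/
def Params.last (Θ : Params K d n m) : Matrix (Fin K) (Fin d) ℝ := Θ.1

/-- The square matrices `W_1, …, W_{L-1}`. -/
def Params.hidden (Θ : Params K d n m) : Fin m → Matrix (Fin d) (Fin d) ℝ := Θ.2.1

/-- The feature matrix `H_1`. -/
def Params.feat (Θ : Params K d n m) : Matrix (Fin d) (Fin K × Fin n) ℝ := Θ.2.2

open scoped Matrix.Norms.Frobenius in
/-- The Frobenius norm. -/
noncomputable def frob {p q : Type*} [Fintype p] [Fintype q] (A : Matrix p q ℝ) : ℝ := ‖A‖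

/-- The logit matrix `Z = W_L W_{L-1} ⋯ W_1 H_1`; its column `(c, i)` is `z_{ic}`. -/
def logits (Θ : Params K d n m) : Matrix (Fin K) (Fin K × Fin n) ℝ :=
  Θ.last * (List.ofFn Θ.hidden).reverse.prod * Θ.feat

/-- The objective `‖H_1‖_F² + ∑_{l=1}^{L} ‖W_l‖_F²`. -/
noncomputable def objective (Θ : Params K d n m) : ℝ :=
  frob Θ.feat ^ 2 + (∑ j, frob (Θ.hidden j) ^ 2 + frob Θ.last ^ 2)

/-- The feasible set: `(z_{ic})_c - (z_{ic})_{c'} ≥ 1` for all `i` and all `c' ≠ c`. -/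
def feasible (K d n m : ℕ) : Set (Params K d n m) :=
  {Θ | ∀ (c c' : Fin K) (i : Fin n), c' ≠ c → 1 ≤ logits Θ c (c, i) - logits Θ c' (c, i)}

/-- Each of the `L + 1` matrices divided by its own Frobenius norm. -/
noncomputable def normalize (Θ : Params K d n m) : Params K d n m :=
  ((frob Θ.last)⁻¹ • Θ.last, fun j => (frob (Θ.hidden j))⁻¹ • Θ.hidden j,
    (frob Θ.feat)⁻¹ • Θ.feat)

/-- Balancedness: `W_lᵀ W_l = W_{l-1} W_{l-1}ᵀ` for `l = 1, …, L`, with `W_0 = H_1`.  The families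
`(W_lᵀ W_l)_{l=1}^{L}` and `(W_{l-1} W_{l-1}ᵀ)_{l=1}^{L}` are both indexed by `Fin (m + 1)`. -/
def LayerBalanced (Θ : Params K d n m) : Prop :=
  ∀ l : Fin (m + 1),
    (Fin.snoc (fun j => (Θ.hidden j)ᵀ * Θ.hidden j) (Θ.lastᵀ * Θ.last) :
      Fin (m + 1) → Matrix (Fin d) (Fin d) ℝ) l =
    (Fin.cons (Θ.feat * Θ.featᵀ) (fun j => Θ.hidden j * (Θ.hidden j)ᵀ) :
      Fin (m + 1) → Matrix (Fin d) (Fin d) ℝ) l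

/-- The simplex ETF matrix `S = I_K - (1/K) 1_K 1_Kᵀ`. -/
noncomputable def simplexETF (K : ℕ) : Matrix (Fin K) (Fin K) ℝ :=
  1 - (1 / (K : ℝ)) • Matrix.of fun _ _ => (1 : ℝ)

/-- The matrix `S ⊗ 1_nᵀ`: every column `(c, i)` is the `c`-th column of `S`. -/
noncomputable def simplexLogits (K n : ℕ) : Matrix (Fin K) (Fin K × Fin n) ℝ :=
  Matrix.of fun a p => simplexETF K a p.1

/-- Deep neural collapse: the normalized matrices are balanced, and their product is a positive
multiple of `S ⊗ 1_nᵀ`. -/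
def IsDNC (Θ : Params K d n m) : Prop :=
  LayerBalanced (normalize Θ) ∧ ∃ t : ℝ, 0 < t ∧ logits (normalize Θ) = t • simplexLogits K n

/-- `IsDNC` does not see the norms of the individual matrices.  The DNC solutions of the
constrained problem are the feasible DNC configurations at their best scaling, that is, those
whose objective is least among all feasible DNC configurations. -/
def IsDNCSolution (Θ : Params K d n m) : Prop :=
  (Θ ∈ feasible K d n m ∧ IsDNC Θ) ∧
    ∀ Θ' ∈ feasible K d n m, IsDNC Θ' → objective Θ ≤ objective Θ'

end DeepUFM

/-! Put r = K - 1 and m = L - 1, let the columns of U be an orthonormal basis of the complement of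
the all-ones vector, and let M be the matrix of class means of the logits. Iterated QR turns the
compressed logits into a product of m + 2 square r × r factors, none larger in Frobenius norm than
its layer. For each factor R, ‖R/a‖² ≥ r + log det(R/a)². With a^(2(m+2)) = n these add up to E ≥
a²((m+2)r + log det(UᵀMU)²) whenever that determinant is nonzero
(`log_det_classMeans_le_objective`). Equality makes every layer a times a partial isometry, fitting
its neighbours, which yields balancedness.

At the simplex UᵀMU = 1, and the bound is V = a²(m+2)r. For feasible logits near the simplex the
determinant is at least 1, since its first-order change is the total slack in the margins divided by
K, and the remainder is smaller than that (`eventually_one_le_det`). Hence DNC solutions are local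
minima, and any nearby feasible point of value at most V meets all equality cases and is itself a
DNC solution. This sign is only local: far from the simplex the determinant may drop below 1 or
vanish.

The better competitor uses the same power T^(m+2) in place of S^(m+2) = S, where T encodes q
antipodal pairs and otherwise orthogonal classes (`exists_root_margin`). Its rank is lower by q - 1,
which outweighs its larger singular values. Compact sublevel sets provide the global minimizer. -/

namespace DeepUFM

variable {p q r : Type*} [Fintype p] [Fintype q] [Fintype r]

/-! ### Frobenius norm and compression by isometries. -/

open scoped Matrix.Norms.Frobenius in
theorem frob_sq (A : Matrix p q ℝ) : frob A ^ 2 = ∑ i, ∑ j, A i j ^ 2 := by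
  unfold frob
  rw [Matrix.frobenius_norm_def, ← Real.sqrt_eq_rpow, Real.sq_sqrt (by positivity)]
  simp

open scoped Matrix.Norms.Frobenius in
theorem frob_nonneg (A : Matrix p q ℝ) : 0 ≤ frob A := norm_nonneg _

open scoped Matrix.Norms.Frobenius in
theorem frob_smul (c : ℝ) (A : Matrix p q ℝ) : frob (c • A) = |c| * frob A := norm_smul _ _

open scoped Matrix.Norms.Frobenius in
theorem frob_eq_zero {A : Matrix p q ℝ} : frob A = 0 ↔ A = 0 := norm_eq_zero

theorem frob_sq_eq_trace (A : Matrix p q ℝ) : frob A ^ 2 = (Aᵀ * A).trace := by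
  rw [frob_sq, Finset.sum_comm]
  simp [Matrix.trace, Matrix.mul_apply, sq]

theorem frob_sq_transpose (A : Matrix p q ℝ) : frob Aᵀ ^ 2 = frob A ^ 2 := by
  rw [frob_sq, frob_sq, Finset.sum_comm]
  simp

/-- Pythagoras for the rows of `A`: Q Qᵀ is the orthogonal projection onto the range of Q. -/
theorem frob_sq_eq_add_of_isometry [DecidableEq r] (A : Matrix p q ℝ) {Q : Matrix q r ℝ}
    (hQ : Qᵀ * Q = 1) :
    frob A ^ 2 = frob (A * Q) ^ 2 + frob (A - A * Q * Qᵀ) ^ 2 := by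
  have h1 : (Qᵀ * (Aᵀ * A)  * Q).trace = (Aᵀ * A * Q * Qᵀ).trace := by
    rw [Matrix.mul_assoc Qᵀ, Matrix.trace_mul_comm]
  have h2 : (Q * (Qᵀ * (Aᵀ * A))).trace = (Aᵀ * A * Q * Qᵀ).trace := by
    rw [← Matrix.mul_assoc, Matrix.trace_mul_comm]
    simp only [Matrix.mul_assoc]
  have h3 : (Q * (Qᵀ * (Aᵀ * (A * (Q * Qᵀ))))).trace = (Aᵀ * A * Q * Qᵀ).trace := by
    rw [← Matrix.mul_assoc, Matrix.trace_mul_comm]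
    rw [show Aᵀ * (A * (Q * Qᵀ)) * (Q * Qᵀ) = Aᵀ * A * Q * (Qᵀ * Q) * Qᵀ by
      simp only [Matrix.mul_assoc], hQ, Matrix.mul_one]
  simp only [frob_sq_eq_trace, Matrix.transpose_sub, Matrix.transpose_mul,
    Matrix.transpose_transpose, Matrix.sub_mul, Matrix.mul_sub, Matrix.trace_sub]
  simp only [Matrix.mul_assoc] at *
  linarith

theorem frob_sq_mul_isometry_le [DecidableEq r] (A : Matrix p q ℝ) {Q : Matrix q r ℝ}
    (hQ : Qᵀ * Q = 1) : frob (A * Q) ^ 2 ≤ frob A ^ 2 := by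
  rw [frob_sq_eq_add_of_isometry A hQ]
  nlinarith [sq_nonneg (frob (A - A * Q * Qᵀ))]

theorem eq_mul_of_frob_sq_le [DecidableEq r] {A : Matrix p q ℝ} {Q : Matrix q r ℝ}
    (hQ : Qᵀ * Q = 1) (h : frob A ^ 2 ≤ frob (A * Q) ^ 2) : A = A * Q * Qᵀ := by
  rw [frob_sq_eq_add_of_isometry A hQ] at h
  have : frob (A - A * Q * Qᵀ) = 0 := by
    nlinarith [sq_nonneg (frob (A - A * Q * Qᵀ))]
  exact sub_eq_zero.mp (frob_eq_zero.mp this)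

/-- A tall matrix of rank at most `s` factors through an isometry from `ℝˢ`. -/
theorem exists_isometry_factor (C : Matrix p q ℝ) {s : ℕ} (hrank : C.rank ≤ s)
    (hs : s ≤ Fintype.card p) :
    ∃ Q : Matrix p (Fin s) ℝ, Qᵀ * Q = 1 ∧ ∃ Y : Matrix (Fin s) q ℝ, C = Q * Y := by
  classical
  let col : q → EuclideanSpace ℝ p := fun j => WithLp.toLp 2 (fun i => C i j)
  let V : Submodule ℝ (EuclideanSpace ℝ p) := Submodule.span ℝ (Set.range col)
  have hV : Module.finrank ℝ V = C.rank := by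
    rw [Matrix.rank_eq_finrank_span_cols]
    have : V = (Submodule.span ℝ (Set.range C.col)).map
        (WithLp.linearEquiv 2 ℝ (p → ℝ)).symm.toLinearMap := by
      rw [Submodule.map_span, ← Set.range_comp]
      rfl
    rw [this]
    exact LinearEquiv.finrank_map_eq _ _
  let b0 := stdOrthonormalBasis ℝ V
  set t := Module.finrank ℝ V with ht
  have hts : t ≤ s := hV ▸ hrank
  -- An orthonormal basis of the column space, padded by zeros. Only the part indexed by `T` is
  -- orthonormal, and it extends to a basis of the whole space whose first `s` vectors form the
  -- isometry.
  let v : Fin (Fintype.card p) → EuclideanSpace ℝ p := fun i => if h : i.1 < t then (b0 ⟨i.1, h⟩ : EuclideanSpace ℝ p) else 0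
  let T : Set (Fin (Fintype.card p)) := {i | i.1 < t}
  have hv : Orthonormal ℝ (T.domRestrict v) := by
    have h0 : Orthonormal ℝ (fun i => (b0 i : EuclideanSpace ℝ p)) :=
      b0.orthonormal.comp_linearIsometry V.subtypeₗᵢ
    have h1 := h0.comp (fun i : T => (⟨i.1.1, i.2⟩ : Fin t)) (by
      intro a b hab
      simpa [Subtype.ext_iff, Fin.ext_iff] using hab)
    convert h1 using 1
    ext i : 1
    have : i.1.1 < t := i.2
    simp [v, this]
  obtain ⟨b, hb⟩ := hv.exists_orthonormalBasis_extension_of_card_eq (by simp)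
  refine ⟨Matrix.of fun i k => b (Fin.castLE hs k) i, ?_, Matrix.of fun k j =>
    if h : k.1 < t then inner ℝ (b0 ⟨k.1, h⟩ : EuclideanSpace ℝ p) (col j) else 0, ?_⟩
  · ext k l
    have := orthonormal_iff_ite.mp b.orthonormal (Fin.castLE hs l) (Fin.castLE hs k)
    rw [PiLp.inner_apply] at this
    simp only [Fin.castLE_inj] at this
    simp only [Matrix.mul_apply, Matrix.transpose_apply, Matrix.of_apply, Matrix.one_apply]
    simpa [eq_comm] using this
  · ext i j
    have hj : col j ∈ V := Submodule.subset_span ⟨j, rfl⟩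
    have h1 := congrArg (fun x : V => (x : EuclideanSpace ℝ p) i) (b0.sum_repr' ⟨col j, hj⟩)
    simp only [Submodule.coe_inner, AddSubmonoidClass.coe_finsetSum, Submodule.coe_smul] at h1
    have h2 : (col j) i = C i j := rfl
    rw [← h2, ← h1]
    simp only [Matrix.mul_apply, Matrix.of_apply]
    obtain ⟨u, rfl⟩ := Nat.exists_eq_add_of_le hts
    rw [Fin.sum_univ_add]
    have h3 : ∀ x : Fin t, b (Fin.castLE hs (Fin.castAdd u x)) = b0 x := by
      intro x
      rw [hb _ (by simp [T])]
      simp [v]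
    simp only [Fin.val_castAdd, Fin.is_lt, dif_pos, h3, Fin.val_natAdd]
    simp [WithLp.ofLp_sum, Finset.sum_apply, mul_comm]

/-! ### Log-determinant inequality and derivative of the determinant. -/

/-- The tangent inequality for `log det`, with its equality case. -/
theorem add_log_det_sq_le_frob_sq [DecidableEq r] {R : Matrix r r ℝ} (hR : R.det ≠ 0) :
    Fintype.card r + Real.log (R.det ^ 2) ≤ frob R ^ 2 ∧
      (frob R ^ 2 ≤ Fintype.card r + Real.log (R.det ^ 2) → Rᵀ * R = 1) := by
  have hH : (Rᵀ * R).IsHermitian := by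
    simpa using Matrix.isHermitian_conjTranspose_mul_self R
  have hP : (Rᵀ * R).PosSemidef := by
    simpa using Matrix.posSemidef_conjTranspose_mul_self R
  have hdet : R.det ^ 2 = ∏ i, hH.eigenvalues i := by
    have := hH.det_eq_prod_eigenvalues
    simp only [Matrix.det_mul, Matrix.det_transpose] at this
    simpa [sq] using this
  have htr : frob R ^ 2 = ∑ i, hH.eigenvalues i := by
    rw [frob_sq_eq_trace]
    simpa using hH.trace_eq_sum_eigenvalues
  have hne : ∀ i, hH.eigenvalues i ≠ 0 := by
    have : ∏ i, hH.eigenvalues i ≠ 0 := hdet ▸ pow_ne_zero 2 hR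
    simpa [Finset.prod_ne_zero_iff] using this
  have hpos : ∀ i, 0 < hH.eigenvalues i := fun i =>
    lt_of_le_of_ne (hP.eigenvalues_nonneg i) (hne i).symm
  have hle : ∀ i ∈ Finset.univ, Real.log (hH.eigenvalues i) + 1 ≤ hH.eigenvalues i := fun i _ => by
    linarith [Real.log_le_sub_one_of_pos (hpos i)]
  have hsum : (Fintype.card r : ℝ) + Real.log (R.det ^ 2)
      = ∑ i, (Real.log (hH.eigenvalues i) + 1) := by
    rw [hdet, Real.log_prod (fun i _ => hne i), Finset.sum_add_distrib]
    simp [add_comm]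
  rw [hsum, htr]
  refine ⟨Finset.sum_le_sum hle, fun h => ?_⟩
  -- Equality of the sums forces equality for each eigenvalue, and log x = x - 1 only at x = 1.
  have heq := (Finset.sum_eq_sum_iff_of_le hle).mp (le_antisymm (Finset.sum_le_sum hle) h)
  have h1 : ∀ i, hH.eigenvalues i = 1 := by
    intro i
    by_contra hi
    linarith [Real.log_lt_sub_one_of_pos (hpos i) hi, heq i (Finset.mem_univ i)]
  rw [hH.spectral_theorem]
  have : (RCLike.ofReal ∘ hH.eigenvalues : r → ℝ) = fun _ => 1 := by
    ext i; simp [h1]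
  rw [this, Matrix.diagonal_one]
  simp

/-- `det (1 + X) = 1 + tr X + o(X)`, with an error controlled by the entries of `X`. -/
theorem hasFDerivAt_det_one [DecidableEq r] :
    ∃ f' : (r → r → ℝ) →L[ℝ] ℝ, (∀ X, f' X = (Matrix.of X).trace) ∧
      HasFDerivAt (fun X : r → r → ℝ => (Matrix.of X).det) f' (fun i j => (1 : Matrix r r ℝ) i j) := by
  have hd : Differentiable ℝ (fun X : r → r → ℝ => (Matrix.of X).det) := by
    simp only [Matrix.det_apply', Matrix.of_apply]
    fun_prop
  refine ⟨_, fun X => ?_, (hd _).hasFDerivAt⟩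
  have h1 := (hd (fun i j => (1 : Matrix r r ℝ) i j)).hasFDerivAt
  -- The derivative is identified direction by direction, by comparison with the polynomial t ↦
  -- det(1 + tX).
  have h2 : HasDerivAt (fun t : ℝ => (fun i j => (1 : Matrix r r ℝ) i j) + t • X) X 0 := by
    simpa using ((hasDerivAt_id (0 : ℝ)).smul_const X).const_add
      (fun i j => (1 : Matrix r r ℝ) i j)
  have h3 := HasFDerivAt.comp_hasDerivAt_of_eq (0 : ℝ) h1 h2 (by simp)
  have h4 : HasDerivAt (fun t : ℝ => Polynomial.eval t
      (Matrix.det (1 + (Polynomial.X : Polynomial ℝ) • (Matrix.of X).map Polynomial.C)))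
      (Matrix.of X).trace 0 := by
    rw [← Matrix.derivative_det_one_add_X_smul]
    exact Polynomial.hasDerivAt _ _
  refine h3.unique (h4.congr_of_eventuallyEq (Filter.Eventually.of_forall fun t => ?_))
  simp only [Function.comp]
  rw [← Polynomial.coe_evalRingHom, RingHom.map_det]
  congr 1
  ext i j
  simp [Matrix.one_apply]
  split_ifs <;> simp [mul_comm]

/-! ### Iterated QR and the lower bound for the objective. -/

theorem prod_reverse_ofFn_succ {M : Type*} [Monoid M] {m : ℕ} (W : Fin (m + 1) → M) :
    (List.ofFn W).reverse.prod
      = W (Fin.last m) * (List.ofFn fun i : Fin m => W i.castSucc).reverse.prod := by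
  rw [List.ofFn_succ']
  simp

theorem det_prod_reverse_ofFn {r : Type*} [Fintype r] [DecidableEq r] {m : ℕ}
    (R : Fin m → Matrix r r ℝ) : (List.ofFn R).reverse.prod.det = ∏ j, (R j).det := by
  induction m with
  | zero => simp
  | succ m ih => rw [prod_reverse_ofFn_succ, Matrix.det_mul, ih, Fin.prod_univ_castSucc, mul_comm]

/-- Iterated QR factorization along a product of square matrices. -/
theorem exists_isometry_chain {d r m : ℕ} (hr : r ≤ d) (W : Fin m → Matrix (Fin d) (Fin d) ℝ)
    {Q₀ : Matrix (Fin d) (Fin r) ℝ} (hQ₀ : Q₀ᵀ * Q₀ = 1) :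
    ∃ (Q : Fin (m + 1) → Matrix (Fin d) (Fin r) ℝ) (R : Fin m → Matrix (Fin r) (Fin r) ℝ),
      Q 0 = Q₀ ∧ (∀ l, (Q l)ᵀ * Q l = 1) ∧ (∀ j, W j * Q j.castSucc = Q j.succ * R j) ∧
      (List.ofFn W).reverse.prod * Q₀ = Q (Fin.last m) * (List.ofFn R).reverse.prod := by
  induction m with
  | zero => exact ⟨fun _ => Q₀, Fin.elim0, rfl, fun _ => hQ₀, fun j => j.elim0, by simp⟩
  | succ m ih =>
    obtain ⟨Q, R, h0, hQ, hR, hprod⟩ := ih (fun j => W j.castSucc)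
    obtain ⟨Q', hQ', R', hR'⟩ := exists_isometry_factor (W (Fin.last m) * Q (Fin.last m))
      (s := r) (by simpa using Matrix.rank_le_width (W (Fin.last m) * Q (Fin.last m))) (by simpa)
    refine ⟨Fin.snoc Q Q', Fin.snoc R R', ?_, fun l => ?_, fun j => ?_, ?_⟩
    · rw [← Fin.castSucc_zero, Fin.snoc_castSucc, h0]
    · refine Fin.lastCases ?_ (fun i => ?_) l
      · simpa using hQ'
      · simpa using hQ i
    · refine Fin.lastCases ?_ (fun i => ?_) j
      · simpa using hR'
      · simpa [← Fin.castSucc_succ] using hR i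
    · rw [prod_reverse_ofFn_succ, prod_reverse_ofFn_succ, Matrix.mul_assoc, hprod,
        ← Matrix.mul_assoc, hR']
      simp [Matrix.mul_assoc]

/-- The tangent point is moved to a times an orthogonal matrix. Both Gram identities are needed, one
for each neighbouring layer. -/
theorem scaled_add_log_det_sq_le_frob_sq {r : ℕ} {R : Matrix (Fin r) (Fin r) ℝ} (hR : R.det ≠ 0)
    {a : ℝ} (ha : 0 < a) :
    r + Real.log (R.det ^ 2 / a ^ (2 * r)) ≤ frob R ^ 2 / a ^ 2 ∧
      (frob R ^ 2 / a ^ 2 ≤ r + Real.log (R.det ^ 2 / a ^ (2 * r)) →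
        Rᵀ * R = a ^ 2 • 1 ∧ R * Rᵀ = a ^ 2 • 1) := by
  have hd : (a⁻¹ • R).det = R.det / a ^ r := by
    rw [Matrix.det_smul]
    simp [div_eq_inv_mul]
  have hf : frob (a⁻¹ • R) ^ 2 = frob R ^ 2 / a ^ 2 := by
    rw [frob_smul, mul_pow, sq_abs, inv_pow, div_eq_inv_mul]
  have h := add_log_det_sq_le_frob_sq (R := a⁻¹ • R) (by
    rw [hd]; positivity)
  rw [hd, hf, div_pow, ← pow_mul, mul_comm r 2, Fintype.card_fin] at h
  refine ⟨h.1, fun h' => ?_⟩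
  have h1 := h.2 h'
  have h2 := mul_eq_one_comm.mp h1
  rw [Matrix.transpose_smul, Matrix.smul_mul, Matrix.mul_smul, smul_smul] at h1 h2
  constructor
  · rw [← h1, smul_smul, show a ^ 2 * (a⁻¹ * a⁻¹) = 1 by field_simp, one_smul]
  · rw [← h2, smul_smul, show a ^ 2 * (a⁻¹ * a⁻¹) = 1 by field_simp, one_smul]

/-- The layers of `Θ` are, up to the common factor `a`, partial isometries that fit together,
with outermost frames `U` and `E`. -/
structure IsAligned {K d n m r : ℕ} (Θ : Params K d n m) (U : Matrix (Fin K) (Fin r) ℝ)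
    (E : Matrix (Fin K × Fin n) (Fin r) ℝ) (a : ℝ) (Q : Fin (m + 1) → Matrix (Fin d) (Fin r) ℝ) :
    Prop where
  feat_mul : Θ.feat * Θ.featᵀ = a ^ 2 • (Q 0 * (Q 0)ᵀ)
  mul_hidden : ∀ j, (Θ.hidden j)ᵀ * Θ.hidden j = a ^ 2 • (Q j.castSucc * (Q j.castSucc)ᵀ)
  hidden_mul : ∀ j, Θ.hidden j * (Θ.hidden j)ᵀ = a ^ 2 • (Q j.succ * (Q j.succ)ᵀ)
  mul_last : Θ.lastᵀ * Θ.last = a ^ 2 • (Q (Fin.last m) * (Q (Fin.last m))ᵀ)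
  feat_frob : frob Θ.feat ^ 2 = a ^ 2 * r
  hidden_frob : ∀ j, frob (Θ.hidden j) ^ 2 = a ^ 2 * r
  last_frob : frob Θ.last ^ 2 = a ^ 2 * r
  feat_frame : Θ.feat = Θ.feat * E * Eᵀ
  last_frame : Θ.last = U * Uᵀ * Θ.last

theorem sandwich_gram {p q r : Type*} [Fintype p] [Fintype q] [Fintype r] [DecidableEq r]
    {Q : Matrix p r ℝ} {P : Matrix q r ℝ} {R : Matrix r r ℝ} {c : ℝ} (hQ : Qᵀ * Q = 1)
    (hR : Rᵀ * R = c • 1) : (Q * R * Pᵀ)ᵀ * (Q * R * Pᵀ) = c • (P * Pᵀ) := by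
  calc (Q * R * Pᵀ)ᵀ * (Q * R * Pᵀ) = P * (Rᵀ * (Qᵀ * Q) * R) * Pᵀ := by
        simp only [Matrix.transpose_mul, Matrix.transpose_transpose, Matrix.mul_assoc]
    _ = c • (P * Pᵀ) := by
        rw [hQ, Matrix.mul_one, hR]; simp

theorem sandwich_gram' {p q r : Type*} [Fintype p] [Fintype q] [Fintype r] [DecidableEq r]
    {Q : Matrix p r ℝ} {P : Matrix q r ℝ} {R : Matrix r r ℝ} {c : ℝ} (hP : Pᵀ * P = 1)
    (hR : R * Rᵀ = c • 1) : (Q * R * Pᵀ) * (Q * R * Pᵀ)ᵀ = c • (Q * Qᵀ) := by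
  have := sandwich_gram (Q := P) (P := Q) (R := Rᵀ) hP (by simpa using hR)
  simpa [Matrix.mul_assoc] using this

theorem frob_sq_sandwich {p q : Type*} {r : ℕ} [Fintype p] [Fintype q]
    {Q : Matrix p (Fin r) ℝ} {P : Matrix q (Fin r) ℝ} {R : Matrix (Fin r) (Fin r) ℝ} {c : ℝ}
    (hQ : Qᵀ * Q = 1) (hP : Pᵀ * P = 1) (hR : Rᵀ * R = c • 1) :
    frob (Q * R * Pᵀ) ^ 2 = c * r := by
  rw [frob_sq_eq_trace, sandwich_gram hQ hR, Matrix.trace_smul, Matrix.trace_mul_comm, hP]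
  simp

/-- The objective is bounded below by a log-determinant of the compressed logits; equality
forces all layers to be aligned. -/
theorem add_log_det_sq_le_objective {K d n m r : ℕ} (hr : r ≤ d) (Θ : Params K d n m)
    {U : Matrix (Fin K) (Fin r) ℝ} (hU : Uᵀ * U = 1)
    {E : Matrix (Fin K × Fin n) (Fin r) ℝ} (hE : Eᵀ * E = 1)
    (hdet : (Uᵀ * logits Θ * E).det ≠ 0) {a : ℝ} (ha : 0 < a) :
    (m + 2) * r + Real.log ((Uᵀ * logits Θ * E).det ^ 2 / a ^ (2 * r * (m + 2)))
        ≤ objective Θ / a ^ 2 ∧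
      (objective Θ / a ^ 2 ≤
        (m + 2) * r + Real.log ((Uᵀ * logits Θ * E).det ^ 2 / a ^ (2 * r * (m + 2))) →
        ∃ Q, IsAligned Θ U E a Q) := by
  obtain ⟨Q₀, hQ₀, R₀, hR₀⟩ := exists_isometry_factor (Θ.feat * E)
      (s := r) (by simpa using Matrix.rank_le_width (Θ.feat * E)) (by simpa)
  obtain ⟨Q, R, rfl, hQ, hR, hprod⟩ := exists_isometry_chain hr Θ.hidden hQ₀
  set RL := Uᵀ * Θ.last * Q (Fin.last m) with hRL
  have hfac : Uᵀ * logits Θ * E = RL * (List.ofFn R).reverse.prod * R₀ := by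
    calc Uᵀ * logits Θ * E
        = Uᵀ * Θ.last * ((List.ofFn Θ.hidden).reverse.prod * (Θ.feat * E)) := by
          simp only [logits, Matrix.mul_assoc]
      _ = _ := by
          rw [hR₀, ← Matrix.mul_assoc _ (Q 0), hprod, hRL]
          simp only [Matrix.mul_assoc]
  have hdetfac : (Uᵀ * logits Θ * E).det = RL.det * (∏ j, (R j).det) * R₀.det := by
    rw [hfac, Matrix.det_mul, Matrix.det_mul, det_prod_reverse_ofFn]
  rw [hdetfac] at hdet ⊢
  have hdL : RL.det ≠ 0 := fun h => hdet (by simp [h])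
  have hd0 : R₀.det ≠ 0 := fun h => hdet (by simp [h])
  have hdj : ∀ j, (R j).det ≠ 0 := by
    have : ∏ j, (R j).det ≠ 0 := fun h => hdet (by simp [h])
    simpa [Finset.prod_ne_zero_iff] using this
  have tL := scaled_add_log_det_sq_le_frob_sq hdL ha
  have t0 := scaled_add_log_det_sq_le_frob_sq hd0 ha
  have tj := fun j => scaled_add_log_det_sq_le_frob_sq (hdj j) ha
  have hlog : Real.log ((RL.det * (∏ j, (R j).det) * R₀.det) ^ 2 / a ^ (2 * r * (m + 2)))
      = Real.log (RL.det ^ 2 / a ^ (2 * r)) + ∑ j, Real.log ((R j).det ^ 2 / a ^ (2 * r))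
        + Real.log (R₀.det ^ 2 / a ^ (2 * r)) := by
    have hne : ∀ j ∈ Finset.univ, (R j).det ^ 2 / a ^ (2 * r) ≠ 0 := fun j _ =>
      div_ne_zero (pow_ne_zero 2 (hdj j)) (by positivity)
    rw [← Real.log_prod hne, ← Real.log_mul (div_ne_zero (pow_ne_zero 2 hdL) (by positivity))
      (Finset.prod_ne_zero_iff.mpr hne), ← Real.log_mul (mul_ne_zero
      (div_ne_zero (pow_ne_zero 2 hdL) (by positivity)) (Finset.prod_ne_zero_iff.mpr hne))
      (div_ne_zero (pow_ne_zero 2 hd0) (by positivity)), Finset.prod_div_distrib,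
      Finset.prod_const, Finset.prod_pow, Finset.card_univ, Fintype.card_fin]
    congr 1
    field_simp
    ring
  -- Compressing a layer by the frames on either side never increases its norm.
  have cRL : frob RL ^ 2 ≤ frob (Uᵀ * Θ.last) ^ 2 := frob_sq_mul_isometry_le _ (hQ _)
  have cU : frob (Uᵀ * Θ.last) ^ 2 ≤ frob Θ.last ^ 2 := by
    rw [← frob_sq_transpose, ← frob_sq_transpose Θ.last, Matrix.transpose_mul,
      Matrix.transpose_transpose]
    exact frob_sq_mul_isometry_le _ hU
  have hQR : ∀ {s : ℕ} {P : Matrix (Fin d) (Fin s) ℝ} {T : Matrix (Fin s) (Fin r) ℝ},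
      Pᵀ * P = 1 → frob (P * T) ^ 2 = frob T ^ 2 := by
    intro s P T hP
    rw [frob_sq_eq_trace, frob_sq_eq_trace, Matrix.transpose_mul, Matrix.mul_assoc,
      ← Matrix.mul_assoc Pᵀ, hP, Matrix.one_mul]
  have c0' : frob R₀ ^ 2 = frob (Θ.feat * E) ^ 2 := by rw [hR₀, hQR (hQ 0)]
  have c0 : frob R₀ ^ 2 ≤ frob Θ.feat ^ 2 := by
    rw [c0']
    exact frob_sq_mul_isometry_le _ hE
  have cj' : ∀ j, frob (R j) ^ 2 = frob (Θ.hidden j * Q j.castSucc) ^ 2 := fun j => by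
    rw [hR j, hQR (hQ _)]
  have cj : ∀ j, frob (R j) ^ 2 ≤ frob (Θ.hidden j) ^ 2 := fun j => by
    rw [cj']
    exact frob_sq_mul_isometry_le _ (hQ _)
  have ha2 : 0 < a ^ 2 := by positivity
  have dL := div_le_div_of_nonneg_right (cRL.trans cU) ha2.le
  have d0 := div_le_div_of_nonneg_right c0 ha2.le
  have dj := fun j => div_le_div_of_nonneg_right (cj j) ha2.le
  have hobj : objective Θ / a ^ 2 = frob Θ.feat ^ 2 / a ^ 2
      + (∑ j, frob (Θ.hidden j) ^ 2 / a ^ 2 + frob Θ.last ^ 2 / a ^ 2) := by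
    rw [objective, add_div, add_div, Finset.sum_div]
  have hsumr : ∑ j : Fin m, ((r : ℝ) + Real.log ((R j).det ^ 2 / a ^ (2 * r)))
      = m * r + ∑ j, Real.log ((R j).det ^ 2 / a ^ (2 * r)) := by
    rw [Finset.sum_add_distrib]; simp
  have hsum : ∑ j : Fin m, ((r : ℝ) + Real.log ((R j).det ^ 2 / a ^ (2 * r)))
      ≤ ∑ j, frob (Θ.hidden j) ^ 2 / a ^ 2 :=
    Finset.sum_le_sum fun j _ => (tj j).1.trans (dj j)
  rw [hlog, hobj]
  refine ⟨by linarith [tL.1, t0.1], fun h => ?_⟩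
  -- All layerwise inequalities point the same way, so equality of the totals makes each of them
  -- tight.
  have gL : frob Θ.last ^ 2 / a ^ 2 ≤ r + Real.log (RL.det ^ 2 / a ^ (2 * r)) := by
    linarith [t0.1]
  have g0 : frob Θ.feat ^ 2 / a ^ 2 ≤ r + Real.log (R₀.det ^ 2 / a ^ (2 * r)) := by
    linarith [tL.1]
  have gj : ∀ j, frob (Θ.hidden j) ^ 2 / a ^ 2 ≤ r + Real.log ((R j).det ^ 2 / a ^ (2 * r)) := by
    have hge : ∑ j, frob (Θ.hidden j) ^ 2 / a ^ 2 ≤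
        ∑ j : Fin m, ((r : ℝ) + Real.log ((R j).det ^ 2 / a ^ (2 * r))) := by
      linarith [t0.1, tL.1]
    have := (Finset.sum_eq_sum_iff_of_le
      (fun j (_ : j ∈ Finset.univ) => (tj j).1.trans (dj j))).mp (le_antisymm hsum hge)
    exact fun j => (this j (Finset.mem_univ j)).ge
  have back : ∀ {x y : ℝ}, x / a ^ 2 ≤ y / a ^ 2 → x ≤ y := fun h =>
    (div_le_div_iff_of_pos_right ha2).mp h
  have eL := tL.2 (dL.trans gL)
  have e0 := t0.2 (d0.trans g0)
  have ej := fun j => (tj j).2 ((dj j).trans (gj j))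
  -- Tight compression means that nothing of a layer lies outside its frames, so each layer is
  -- recovered from its square factor.
  have fL : frob Θ.last ^ 2 ≤ frob RL ^ 2 := back (gL.trans tL.1)
  have feat_eq : Θ.feat = Θ.feat * E * Eᵀ :=
    eq_mul_of_frob_sq_le hE (by rw [← c0']; exact back (g0.trans t0.1))
  have hidden_eq : ∀ j, Θ.hidden j = Q j.succ * R j * (Q j.castSucc)ᵀ := fun j => by
    rw [← hR j]
    exact eq_mul_of_frob_sq_le (hQ _) (by rw [← cj']; exact back ((gj j).trans (tj j).1))
  have hUL : Uᵀ * Θ.last = RL * (Q (Fin.last m))ᵀ :=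
    eq_mul_of_frob_sq_le (hQ _) (cU.trans fL)
  have last_frame : Θ.last = U * Uᵀ * Θ.last := by
    have : Θ.lastᵀ = Θ.lastᵀ * U * Uᵀ := by
      refine eq_mul_of_frob_sq_le hU ?_
      rw [← frob_sq_transpose (Θ.lastᵀ * U), frob_sq_transpose, Matrix.transpose_mul,
        Matrix.transpose_transpose]
      exact fL.trans cRL
    have h2 := congrArg Matrix.transpose this
    simpa [Matrix.mul_assoc] using h2
  have last_eq : Θ.last = U * RL * (Q (Fin.last m))ᵀ := by
    rw [Matrix.mul_assoc, ← hUL, ← Matrix.mul_assoc]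
    exact last_frame
  have feat_eq' : Θ.feat = Q 0 * R₀ * Eᵀ := by rw [← hR₀]; exact feat_eq
  refine ⟨Q, ?_, fun j => ?_, fun j => ?_, ?_, ?_, fun j => ?_, ?_, feat_eq, last_frame⟩
  · rw [feat_eq']; exact sandwich_gram' hE e0.2
  · rw [hidden_eq]; exact sandwich_gram (hQ _) (ej j).1
  · rw [hidden_eq]; exact sandwich_gram' (hQ _) (ej j).2
  · rw [last_eq]; exact sandwich_gram hU eL.1
  · rw [feat_eq']; exact frob_sq_sandwich (hQ _) hE e0.1
  · rw [hidden_eq]; exact frob_sq_sandwich (hQ _) (hQ _) (ej j).1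
  · rw [last_eq]; exact frob_sq_sandwich hU (hQ _) eL.1

/-! ### The simplex, its frame, and class means. -/

/-- The matrix `I_K ⊗ 1_nᵀ`, which repeats every column `n` times. -/
def replicateCols (K n : ℕ) : Matrix (Fin K) (Fin K × Fin n) ℝ :=
  Matrix.of fun c p => if c = p.1 then 1 else 0

theorem mul_replicateCols_apply {p : Type*} {K n : ℕ} (A : Matrix p (Fin K) ℝ) (a : p)
    (c : Fin K × Fin n) : (A * replicateCols K n) a c = A a c.1 := by
  simp [Matrix.mul_apply, replicateCols]

theorem mul_replicateCols_transpose_apply {p : Type*} {K n : ℕ}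
    (Z : Matrix p (Fin K × Fin n) ℝ) (a : p) (c : Fin K) :
    (Z * (replicateCols K n)ᵀ) a c = ∑ i, Z a (c, i) := by
  rw [Matrix.mul_apply, Fintype.sum_prod_type]
  simp [replicateCols]

theorem replicateCols_mul_transpose (K n : ℕ) :
    replicateCols K n * (replicateCols K n)ᵀ = (n : ℝ) • 1 := by
  ext a c
  rw [mul_replicateCols_transpose_apply]
  simp only [replicateCols, Matrix.of_apply, Matrix.smul_apply, Matrix.one_apply]
  split_ifs <;> simp

theorem simplexLogits_eq (K n : ℕ) :
    simplexLogits K n = simplexETF K * replicateCols K n := by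
  ext a p
  rw [mul_replicateCols_apply]
  rfl

theorem simplexETF_apply (K : ℕ) (a c : Fin K) :
    simplexETF K a c = (if a = c then 1 else 0) - 1 / (K : ℝ) := by
  simp [simplexETF, Matrix.one_apply]

theorem simplexETF_transpose (K : ℕ) : (simplexETF K)ᵀ = simplexETF K := by
  ext a c
  simp [simplexETF_apply, eq_comm]

theorem simplexETF_mul_apply {p : Type*} {K : ℕ} (M : Matrix (Fin K) p ℝ) (a : Fin K) (c : p) :
    (simplexETF K * M) a c = M a c - (∑ b, M b c) / K := by
  simp only [Matrix.mul_apply, simplexETF_apply, sub_mul, Finset.sum_sub_distrib, ite_mul, one_mul,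
    zero_mul, Finset.sum_ite_eq, Finset.mem_univ, if_true, ← Finset.mul_sum]
  ring

theorem simplexETF_mul_self {K : ℕ} (hK : 1 ≤ K) :
    simplexETF K * simplexETF K = simplexETF K := by
  have hK' : (K : ℝ) ≠ 0 := by positivity
  ext a c
  rw [simplexETF_mul_apply]
  simp [simplexETF_apply, Finset.sum_sub_distrib, hK']

theorem trace_simplexETF {K : ℕ} (hK : 1 ≤ K) : (simplexETF K).trace = ((K - 1 : ℕ) : ℝ) := by
  have hK' : (K : ℝ) ≠ 0 := by positivity
  simp [Matrix.trace, simplexETF_apply, hK', Nat.cast_sub hK]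

/-- S(1 - S) = 0 with 1 - S ≠ 0 bounds the rank of S by K - 1. Then U Uᵀ is a projection fixing S
with the same trace K - 1, so their difference has Frobenius norm zero. -/
theorem exists_frame {K : ℕ} (hK : 1 ≤ K) :
    ∃ U : Matrix (Fin K) (Fin (K - 1)) ℝ, Uᵀ * U = 1 ∧ U * Uᵀ = simplexETF K := by
  have hS := simplexETF_mul_self hK
  have hrank : (simplexETF K).rank ≤ K - 1 := by
    have h0 : simplexETF K * (1 - simplexETF K) = 0 := by rw [Matrix.mul_sub, hS]; simp
    have h1 := Matrix.rank_add_rank_le_card_of_mul_eq_zero h0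
    have h2 : (1 - simplexETF K).rank ≠ 0 := by
      intro h
      obtain ⟨Q, -, Y, hY⟩ := exists_isometry_factor (1 - simplexETF K) h.le (Nat.zero_le _)
      have := congrFun (congrFun hY ⟨0, hK⟩) ⟨0, hK⟩
      simp [simplexETF_apply, Matrix.mul_apply] at this
      omega
    rw [Fintype.card_fin] at h1
    omega
  obtain ⟨U, hU, Y, hY⟩ := exists_isometry_factor (simplexETF K) hrank (by simp)
  refine ⟨U, hU, ?_⟩
  have h1 : U * Uᵀ * simplexETF K = simplexETF K := by
    rw [hY, Matrix.mul_assoc, ← Matrix.mul_assoc Uᵀ, hU, Matrix.one_mul]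
  have h2 : simplexETF K * (U * Uᵀ) = simplexETF K := by
    have := congrArg Matrix.transpose h1
    simpa [simplexETF_transpose] using this
  have h3 : U * Uᵀ * (U * Uᵀ) = U * Uᵀ := by
    rw [Matrix.mul_assoc, ← Matrix.mul_assoc Uᵀ, hU, Matrix.one_mul]
  have h4 : frob (U * Uᵀ - simplexETF K) ^ 2 = 0 := by
    rw [frob_sq_eq_trace, Matrix.transpose_sub, Matrix.transpose_mul, Matrix.transpose_transpose,
      simplexETF_transpose, Matrix.sub_mul, Matrix.mul_sub, Matrix.mul_sub, h1, h2, h3, hS]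
    rw [sub_self, sub_zero, Matrix.trace_sub, trace_simplexETF hK, Matrix.trace_mul_comm, hU]
    simp
  exact sub_eq_zero.mp (frob_eq_zero.mp (pow_eq_zero_iff two_ne_zero |>.mp h4))

/-- The frame of the class-mean directions in the space of samples. -/
noncomputable def sampleFrame {K r : ℕ} (n : ℕ) (U : Matrix (Fin K) (Fin r) ℝ) :
    Matrix (Fin K × Fin n) (Fin r) ℝ :=
  (Real.sqrt n)⁻¹ • ((replicateCols K n)ᵀ * U)

/-- The matrix of class means of the logits. -/
noncomputable def classMeans {K n : ℕ} (Z : Matrix (Fin K) (Fin K × Fin n) ℝ) :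
    Matrix (Fin K) (Fin K) ℝ :=
  (n : ℝ)⁻¹ • (Z * (replicateCols K n)ᵀ)

section frames

variable {K n r : ℕ}

theorem inv_sqrt_mul_inv_sqrt (n : ℕ) :
    (Real.sqrt n)⁻¹ * (Real.sqrt n)⁻¹ = (n : ℝ)⁻¹ := by
  rw [← mul_inv, Real.mul_self_sqrt (Nat.cast_nonneg n)]

theorem sampleFrame_isometry (hn : 1 ≤ n) {U : Matrix (Fin K) (Fin r) ℝ} (hU : Uᵀ * U = 1) :
    (sampleFrame n U)ᵀ * sampleFrame n U = 1 := by
  have hn' : (n : ℝ) ≠ 0 := by positivity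
  rw [sampleFrame, Matrix.transpose_smul, Matrix.smul_mul, Matrix.mul_smul, smul_smul,
    inv_sqrt_mul_inv_sqrt, Matrix.transpose_mul, Matrix.transpose_transpose, Matrix.mul_assoc,
    ← Matrix.mul_assoc (replicateCols K n), replicateCols_mul_transpose, Matrix.smul_mul,
    Matrix.one_mul, Matrix.mul_smul, hU, smul_smul, inv_mul_cancel₀ hn', one_smul]

theorem mul_sampleFrame_mul_transpose (Z : Matrix (Fin K) (Fin K × Fin n) ℝ)
    (U : Matrix (Fin K) (Fin r) ℝ) :
    Z * sampleFrame n U * (sampleFrame n U)ᵀ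
      = classMeans Z * (U * Uᵀ) * replicateCols K n := by
  simp only [sampleFrame, classMeans, Matrix.transpose_smul, Matrix.smul_mul, Matrix.mul_smul,
    smul_smul, inv_sqrt_mul_inv_sqrt, Matrix.transpose_mul, Matrix.transpose_transpose,
    Matrix.mul_assoc]

theorem mul_sampleFrame (hn : 1 ≤ n) (Z : Matrix (Fin K) (Fin K × Fin n) ℝ)
    (U : Matrix (Fin K) (Fin r) ℝ) :
    Uᵀ * Z * sampleFrame n U = Real.sqrt n • (Uᵀ * classMeans Z * U) := by
  have hn' : (0 : ℝ) < n := by positivity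
  simp only [sampleFrame, classMeans, Matrix.smul_mul, Matrix.mul_smul, smul_smul,
    Matrix.mul_assoc]
  congr 1
  have := Real.sq_sqrt hn'.le
  have h0 : Real.sqrt n ≠ 0 := by positivity
  field_simp
  exact this.symm

theorem classMeans_mul_replicateCols (hn : 1 ≤ n) (M : Matrix (Fin K) (Fin K) ℝ) :
    classMeans (M * replicateCols K n) = M := by
  have hn' : (n : ℝ) ≠ 0 := by positivity
  rw [classMeans, Matrix.mul_assoc, replicateCols_mul_transpose, Matrix.mul_smul, smul_smul,
    inv_mul_cancel₀ hn', one_smul, Matrix.mul_one]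

/-- The margin constraints are linear, hence survive averaging over a class. -/
theorem classMeans_margin (hn : 1 ≤ n) {Z : Matrix (Fin K) (Fin K × Fin n) ℝ}
    (hZ : ∀ (c c' : Fin K) (i : Fin n), c' ≠ c → 1 ≤ Z c (c, i) - Z c' (c, i))
    (c c' : Fin K) (h : c' ≠ c) : 1 ≤ classMeans Z c c - classMeans Z c' c := by
  have hn' : (0 : ℝ) < n := by positivity
  simp only [classMeans, Matrix.smul_apply, mul_replicateCols_transpose_apply, smul_eq_mul]
  rw [← mul_sub, ← Finset.sum_sub_distrib, ← div_eq_inv_mul, le_div_iff₀ hn']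
  calc (1 : ℝ) * n = ∑ _i : Fin n, (1 : ℝ) := by simp
    _ ≤ _ := Finset.sum_le_sum fun i _ => hZ c c' i h

theorem continuous_classMeans :
    Continuous (classMeans : Matrix (Fin K) (Fin K × Fin n) ℝ → Matrix (Fin K) (Fin K) ℝ) := by
  unfold classMeans
  fun_prop

end frames

/-! ### Local determinant bound at the simplex. -/

/-- Near the simplex, the determinant of the compressed class means of feasible logits is at
least one, and exceeds one unless all margins are tight. -/
theorem eventually_one_le_det {K r : ℕ} (hK : 1 ≤ K) {U : Matrix (Fin K) (Fin r) ℝ}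
    (hU : Uᵀ * U = 1) (hUU : U * Uᵀ = simplexETF K) :
    ∀ᶠ M in 𝓝 (simplexETF K), (∀ c c' : Fin K, c' ≠ c → 1 ≤ M c c - M c' c) →
      1 ≤ (Uᵀ * M * U).det ∧ ((Uᵀ * M * U).det ≤ 1 → simplexETF K * M = simplexETF K) := by
  have hK' : (0 : ℝ) < K := by positivity
  obtain ⟨f', hf', hder⟩ := hasFDerivAt_det_one (r := Fin r)
  let Y : Matrix (Fin K) (Fin K) ℝ → Fin r → Fin r → ℝ := fun M i j => (Uᵀ * M * U) i j
  have hYc : Continuous Y := by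
    refine continuous_pi fun i => continuous_pi fun j => ?_
    have : Continuous fun M : Matrix (Fin K) (Fin K) ℝ => Uᵀ * M * U := by fun_prop
    exact this.matrix_elem i j
  have hUS : Uᵀ * simplexETF K = Uᵀ := by
    rw [← hUU, ← Matrix.mul_assoc, hU, Matrix.one_mul]
  have hSU : simplexETF K * U = U := by
    rw [← hUU, Matrix.mul_assoc, hU, Matrix.mul_one]
  have hY1 : Y (simplexETF K) = fun i j => (1 : Matrix (Fin r) (Fin r) ℝ) i j := by
    funext i j
    simp only [Y, hUS, hU]
  let Llin : (Fin K → Fin K → ℝ) →ₗ[ℝ] (Fin r → Fin r → ℝ) :=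
    { toFun := fun D i j => (Uᵀ * Matrix.of D * U) i j
      map_add' := fun D D' => by
        funext i j
        have : Matrix.of (D + D') = Matrix.of D + Matrix.of D' := rfl
        rw [this, Matrix.mul_add, Matrix.add_mul]
        rfl
      map_smul' := fun c D => by
        funext i j
        have : Matrix.of (c • D) = c • Matrix.of D := rfl
        rw [this, Matrix.mul_smul, Matrix.smul_mul]
        rfl }
  let Lc := LinearMap.toContinuousLinearMap Llin
  set C : ℝ := ‖Lc‖ * K with hC
  have hC0 : 0 ≤ C := by positivity
  -- Chosen so that a perturbation of norm at most C s leaves a remainder of at most s / 2 in the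
  -- expansion of the determinant.
  have hε : 0 < 1 / (2 * (C + 1)) := by positivity
  have hlo := (hasFDerivAt_iff_isLittleO.mp hder).def hε
  have htend : Filter.Tendsto Y (𝓝 (simplexETF K))
      (𝓝 fun i j => (1 : Matrix (Fin r) (Fin r) ℝ) i j) := hY1 ▸ hYc.tendsto _
  filter_upwards [htend.eventually hlo] with M hM hfeas
  -- The slack of each margin constraint, set to zero on the diagonal.
  set δ : Fin K → Fin K → ℝ := fun a c => M c c - M a c - (if a = c then 0 else 1) with hδ
  have hδ0 : ∀ a c, 0 ≤ δ a c := by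
    intro a c
    by_cases h : a = c
    · simp [hδ, h]
    · have := hfeas c a h
      simp only [hδ, if_neg h]
      linarith
  set s : ℝ := (∑ c, ∑ a, δ a c) / K with hs
  have hs0 : 0 ≤ s := div_nonneg (Finset.sum_nonneg fun c _ => Finset.sum_nonneg fun a _ => hδ0 a c)
    hK'.le
  have hcol : ∀ c, ∑ a, δ a c = K * M c c - (∑ a, M a c) - (K - 1) := by
    intro c
    have h1 : ∀ a, δ a c = M c c - M a c - (1 - if a = c then 1 else 0) := fun a => by
      simp only [hδ]; split_ifs <;> ring
    simp only [h1, Finset.sum_sub_distrib]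
    simp
  have hcol_le : ∀ c, ∑ a, δ a c ≤ K * s := by
    intro c
    rw [hs, mul_div_cancel₀ _ hK'.ne']
    exact Finset.single_le_sum (f := fun c => ∑ a, δ a c)
      (fun c _ => Finset.sum_nonneg fun a _ => hδ0 a c) (Finset.mem_univ c)
  -- Adding a constant to a column of M changes no margin, so M - S need not be controlled by the
  -- slacks. Its projection is: each entry of `D` is a combination of slacks in one column.
  set D : Fin K → Fin K → ℝ := fun a c => (simplexETF K * M - simplexETF K) a c with hD
  have hDδ : ∀ a c, D a c = (∑ b, δ b c) / K - δ a c := by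
    intro a c
    rw [hcol]
    simp only [hD, Matrix.sub_apply, simplexETF_mul_apply, simplexETF_apply, hδ]
    by_cases h : a = c
    · subst h; simp; field_simp
    · simp only [if_neg h]; field_simp; ring
  have hDle : ‖D‖ ≤ K * s := by
    have hKs : 0 ≤ K * s := by positivity
    refine (pi_norm_le_iff_of_nonneg hKs).mpr fun a => (pi_norm_le_iff_of_nonneg hKs).mpr fun c => ?_
    rw [hDδ, Real.norm_eq_abs, abs_le]
    have h1 : δ a c ≤ ∑ b, δ b c :=
      Finset.single_le_sum (f := fun b => δ b c) (fun b _ => hδ0 b c) (Finset.mem_univ a)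
    have h2 : (∑ b, δ b c) / K ≤ ∑ b, δ b c :=
      div_le_self (Finset.sum_nonneg fun b _ => hδ0 b c) (by exact_mod_cast hK)
    have h3 : 0 ≤ (∑ b, δ b c) / K :=
      div_nonneg (Finset.sum_nonneg fun b _ => hδ0 b c) hK'.le
    constructor <;> linarith [hδ0 a c, hcol_le c]
  have hXD : (Y M - fun i j => (1 : Matrix (Fin r) (Fin r) ℝ) i j) = Lc D := by
    funext i j
    have : Lc D i j = (Uᵀ * (simplexETF K * M - simplexETF K) * U) i j := rfl
    rw [this, Matrix.mul_sub, ← Matrix.mul_assoc, hUS, Matrix.sub_mul, hU]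
    rfl
  have hXle : ‖Y M - fun i j => (1 : Matrix (Fin r) (Fin r) ℝ) i j‖ ≤ C * s := by
    rw [hXD]
    calc ‖Lc D‖ ≤ ‖Lc‖ * ‖D‖ := Lc.le_opNorm D
      _ ≤ ‖Lc‖ * (K * s) := by gcongr
      _ = C * s := by rw [hC]; ring
  -- The first-order term is the trace of `D`, which is exactly s because the diagonal slacks
  -- vanish.
  have htr : f' (Y M - fun i j => (1 : Matrix (Fin r) (Fin r) ℝ) i j) = s := by
    rw [hf', hXD]
    have : Matrix.of (Lc D) = Uᵀ * (simplexETF K * M - simplexETF K) * U := rfl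
    rw [this, Matrix.trace_mul_comm, ← Matrix.mul_assoc, hUU, Matrix.mul_sub,
      ← Matrix.mul_assoc, simplexETF_mul_self hK]
    have h1 : (simplexETF K * M - simplexETF K).trace = ∑ c, D c c := rfl
    rw [h1, hs, Finset.sum_div]
    refine Finset.sum_congr rfl fun c _ => ?_
    rw [hDδ]
    simp [hδ]
  have hdet1 : (Matrix.of fun i j => (1 : Matrix (Fin r) (Fin r) ℝ) i j).det = 1 := Matrix.det_one
  have hdetM : (Matrix.of (Y M)).det = (Uᵀ * M * U).det := rfl
  rw [htr, hdet1, hdetM] at hM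
  have hbound : 1 / (2 * (C + 1)) * ‖Y M - fun i j => (1 : Matrix (Fin r) (Fin r) ℝ) i j‖
      ≤ s / 2 := by
    calc _ ≤ 1 / (2 * (C + 1)) * (C * s) := by gcongr
      _ ≤ s / 2 := by
        rw [div_mul_eq_mul_div, one_mul, div_le_div_iff₀ (by positivity) (by positivity)]
        nlinarith
  have hfin := (abs_le.mp (hM.trans hbound)).1
  refine ⟨by linarith, fun hle => ?_⟩
  have hs1 : s = 0 := by linarith
  rw [hs1, mul_zero] at hDle
  have hD0 : D = 0 := norm_le_zero_iff.mp hDle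
  ext a c
  have := congrFun (congrFun hD0 a) c
  simp only [hD, Matrix.sub_apply, Pi.zero_apply] at this
  linarith

/-! ### From aligned layers to neural collapse. -/

theorem prod_reverse_ofFn_smul {d m : ℕ} (c : Fin m → ℝ) (W : Fin m → Matrix (Fin d) (Fin d) ℝ) :
    (List.ofFn fun j => c j • W j).reverse.prod = (∏ j, c j) • (List.ofFn W).reverse.prod := by
  induction m with
  | zero => simp
  | succ m ih =>
    rw [prod_reverse_ofFn_succ, ih, prod_reverse_ofFn_succ W, Fin.prod_univ_castSucc,
      Matrix.smul_mul, Matrix.mul_smul, smul_smul, mul_comm]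

section

variable {K d n m r : ℕ}

theorem logits_normalize (Θ : Params K d n m) :
    logits (normalize Θ) = ((frob Θ.last)⁻¹ * (∏ j, (frob (Θ.hidden j))⁻¹) * (frob Θ.feat)⁻¹)
      • logits Θ := by
  have h1 : (normalize Θ).last = (frob Θ.last)⁻¹ • Θ.last := rfl
  have h2 : (normalize Θ).hidden = fun j => (frob (Θ.hidden j))⁻¹ • Θ.hidden j := rfl
  have h3 : (normalize Θ).feat = (frob Θ.feat)⁻¹ • Θ.feat := rfl
  rw [logits, h1, h2, h3, prod_reverse_ofFn_smul]
  simp only [Matrix.smul_mul, Matrix.mul_smul, smul_smul, logits]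
  congr 1
  ring

/-- All layers have the same norm, so normalization rescales the two Gram matrices at each interface
equally. -/
theorem IsAligned.layerBalanced_normalize {Θ : Params K d n m} {U : Matrix (Fin K) (Fin r) ℝ}
    {E : Matrix (Fin K × Fin n) (Fin r) ℝ} {a : ℝ} {Q : Fin (m + 1) → Matrix (Fin d) (Fin r) ℝ}
    (h : IsAligned Θ U E a Q) : LayerBalanced (normalize Θ) := by
  set ν := Real.sqrt (a ^ 2 * r) with hν
  have hL : frob Θ.last = ν := by rw [hν, ← h.last_frob, Real.sqrt_sq (frob_nonneg _)]
  have hF : frob Θ.feat = ν := by rw [hν, ← h.feat_frob, Real.sqrt_sq (frob_nonneg _)]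
  have hH : ∀ j, frob (Θ.hidden j) = ν := fun j => by
    rw [hν, ← h.hidden_frob j, Real.sqrt_sq (frob_nonneg _)]
  have h1 : (normalize Θ).last = ν⁻¹ • Θ.last := by rw [← hL]; rfl
  have h2 : ∀ j, (normalize Θ).hidden j = ν⁻¹ • Θ.hidden j := fun j => by rw [← hH j]; rfl
  have h3 : (normalize Θ).feat = ν⁻¹ • Θ.feat := by rw [← hF]; rfl
  have hG : ∀ l : Fin (m + 1),
      (Fin.snoc (fun j => ((normalize Θ).hidden j)ᵀ * (normalize Θ).hidden j)
        ((normalize Θ).lastᵀ * (normalize Θ).last) : Fin (m + 1) → Matrix (Fin d) (Fin d) ℝ) l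
      = (ν⁻¹ * ν⁻¹) • (a ^ 2 • (Q l * (Q l)ᵀ)) := by
    intro l
    refine Fin.lastCases ?_ (fun j => ?_) l
    · rw [Fin.snoc_last, h1, Matrix.transpose_smul, Matrix.smul_mul, Matrix.mul_smul, smul_smul,
        h.mul_last]
    · rw [Fin.snoc_castSucc, h2, Matrix.transpose_smul, Matrix.smul_mul, Matrix.mul_smul,
        smul_smul, h.mul_hidden]
  have hG' : ∀ l : Fin (m + 1),
      (Fin.cons ((normalize Θ).feat * (normalize Θ).featᵀ)
        (fun j => (normalize Θ).hidden j * ((normalize Θ).hidden j)ᵀ) :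
          Fin (m + 1) → Matrix (Fin d) (Fin d) ℝ) l
      = (ν⁻¹ * ν⁻¹) • (a ^ 2 • (Q l * (Q l)ᵀ)) := by
    intro l
    refine Fin.cases ?_ (fun j => ?_) l
    · rw [Fin.cons_zero, h3, Matrix.transpose_smul, Matrix.smul_mul, Matrix.mul_smul, smul_smul,
        h.feat_mul]
    · rw [Fin.cons_succ, h2, Matrix.transpose_smul, Matrix.smul_mul, Matrix.mul_smul,
        smul_smul, h.hidden_mul]
  intro l
  rw [hG, hG']

theorem IsAligned.isDNC {Θ : Params K d n m} {U : Matrix (Fin K) (Fin r) ℝ}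
    {E : Matrix (Fin K × Fin n) (Fin r) ℝ} {a : ℝ} {Q : Fin (m + 1) → Matrix (Fin d) (Fin r) ℝ}
    (h : IsAligned Θ U E a Q) (ha : 0 < a) (hr : 0 < r) (hZ : logits Θ = simplexLogits K n) :
    IsDNC Θ := by
  have hpos : ∀ x : ℝ, 0 ≤ x → x ^ 2 = a ^ 2 * r → 0 < x := fun x hx h2 =>
    lt_of_le_of_ne hx fun h0 => by
      have : 0 < a ^ 2 * (r : ℝ) := by positivity
      rw [← h0, zero_pow two_ne_zero] at h2
      exact absurd h2 this.ne
  refine ⟨h.layerBalanced_normalize, _, ?_, by rw [logits_normalize, hZ]⟩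
  refine mul_pos (mul_pos (inv_pos.mpr (hpos _ (frob_nonneg _) h.last_frob))
    (Finset.prod_pos fun j _ => inv_pos.mpr (hpos _ (frob_nonneg _) (h.hidden_frob j))))
    (inv_pos.mpr (hpos _ (frob_nonneg _) h.feat_frob))

theorem IsDNC.exists_logits_eq {Θ : Params K d n m} (h : IsDNC Θ) :
    ∃ τ : ℝ, logits Θ = τ • simplexLogits K n := by
  obtain ⟨-, t, -, h⟩ := h
  rw [logits_normalize] at h
  set c := (frob Θ.last)⁻¹ * (∏ j, (frob (Θ.hidden j))⁻¹) * (frob Θ.feat)⁻¹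
  -- Since 0⁻¹ = 0, a vanishing layer makes `c` zero; the logits are then zero as well.
  by_cases hc : c = 0
  · refine ⟨0, ?_⟩
    rcases mul_eq_zero.mp hc with h1 | h1
    · rcases mul_eq_zero.mp h1 with h2 | h2
      · have := frob_eq_zero.mp (inv_eq_zero.mp h2)
        simp [logits, this]
      · obtain ⟨j, -, hj⟩ := Finset.prod_eq_zero_iff.mp h2
        have := frob_eq_zero.mp (inv_eq_zero.mp hj)
        have h0 : (List.ofFn Θ.hidden).reverse.prod = 0 :=
          List.prod_eq_zero (by simpa [List.mem_ofFn] using ⟨j, this⟩)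
        simp [logits, h0]
    · have := frob_eq_zero.mp (inv_eq_zero.mp h1)
      simp [logits, this]
  · refine ⟨c⁻¹ * t, ?_⟩
    rw [← smul_smul, ← h, smul_smul, inv_mul_cancel₀ hc, one_smul]

theorem one_le_of_feasible {Θ : Params K d n m} (hK : 2 ≤ K) (hn : 1 ≤ n)
    (hΘ : Θ ∈ feasible K d n m) {τ : ℝ} (h : logits Θ = τ • simplexLogits K n) : 1 ≤ τ := by
  have := hΘ ⟨0, by omega⟩ ⟨1, by omega⟩ ⟨0, hn⟩ (by simp)
  rw [h] at this
  simp [simplexLogits, simplexETF_apply] at this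
  linarith

theorem feasible_of_logits_eq (Θ : Params K d n m) (h : logits Θ = simplexLogits K n) :
    Θ ∈ feasible K d n m := by
  intro c c' i hc
  rw [h]
  simp [simplexLogits, simplexETF_apply, hc]

/-- The log-determinant bound in terms of class means. -/
theorem log_det_classMeans_le_objective (hr : r ≤ d) (hn : 1 ≤ n) (Θ : Params K d n m)
    {U : Matrix (Fin K) (Fin r) ℝ} (hU : Uᵀ * U = 1)
    (hdet : (Uᵀ * classMeans (logits Θ) * U).det ≠ 0) {a : ℝ} (ha : 0 < a)
    (han : a ^ (2 * (m + 2)) = n) :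
    a ^ 2 * ((m + 2) * r + Real.log ((Uᵀ * classMeans (logits Θ) * U).det ^ 2)) ≤ objective Θ ∧
      (objective Θ ≤
        a ^ 2 * ((m + 2) * r + Real.log ((Uᵀ * classMeans (logits Θ) * U).det ^ 2)) →
        ∃ Q, IsAligned Θ U (sampleFrame n U) a Q) := by
  have hn' : (0 : ℝ) < n := by positivity
  -- The sample frame contributes √n per dimension, and the choice of `a` cancels it exactly.
  have hd : (Uᵀ * logits Θ * sampleFrame n U).det ^ 2 / a ^ (2 * r * (m + 2))
      = (Uᵀ * classMeans (logits Θ) * U).det ^ 2 := by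
    rw [mul_sampleFrame hn, Matrix.det_smul, Fintype.card_fin, mul_pow, ← pow_mul, mul_comm r 2,
      pow_mul, Real.sq_sqrt hn'.le, show 2 * r * (m + 2) = 2 * (m + 2) * r by ring, pow_mul a, han]
    field_simp
  have h := add_log_det_sq_le_objective hr Θ hU (sampleFrame_isometry hn hU) (by
    rw [mul_sampleFrame hn, Matrix.det_smul]
    exact mul_ne_zero (pow_ne_zero _ (Real.sqrt_ne_zero'.mpr hn')) hdet) ha
  rw [hd, le_div_iff₀' (by positivity), div_le_iff₀' (by positivity)] at h
  exact h

/-- The last layer's frame gives S Z = Z and the feature frame removes variation within classes.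
Together they upgrade the hypothesis on projected class means to the full logits. -/
theorem logits_eq_of_aligned (hK : 1 ≤ K) {Θ : Params K d n m}
    {U : Matrix (Fin K) (Fin r) ℝ} (hUU : U * Uᵀ = simplexETF K) {a : ℝ}
    {Q : Fin (m + 1) → Matrix (Fin d) (Fin r) ℝ} (h : IsAligned Θ U (sampleFrame n U) a Q)
    (hM : simplexETF K * classMeans (logits Θ) = simplexETF K) :
    logits Θ = simplexLogits K n := by
  have h1 : simplexETF K * logits Θ = logits Θ := by
    have : simplexETF K * Θ.last = Θ.last := by rw [← hUU]; exact h.last_frame.symm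
    rw [logits, ← Matrix.mul_assoc, ← Matrix.mul_assoc, this]
  have h2 : logits Θ = classMeans (logits Θ) * simplexETF K * replicateCols K n := by
    rw [← hUU, ← mul_sampleFrame_mul_transpose]
    conv_lhs => rw [logits, h.feat_frame]
    simp only [logits, Matrix.mul_assoc]
  have h3 : simplexETF K * classMeans (logits Θ) = classMeans (logits Θ) := by
    conv_rhs => rw [← h1]
    rw [classMeans, classMeans, Matrix.mul_smul, Matrix.mul_assoc]
  rw [h2, ← h3, hM, simplexETF_mul_self hK, simplexLogits_eq]

end

theorem classMeans_smul {K n : ℕ} (c : ℝ) (Z : Matrix (Fin K) (Fin K × Fin n) ℝ) :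
    classMeans (c • Z) = c • classMeans Z := by
  rw [classMeans, classMeans, Matrix.smul_mul, smul_comm]

/-! ### Explicit parameters realizing a matrix power. -/

section construction

variable {K d n m : ℕ}

/-- The coordinate embedding of `ℝᴷ` into `ℝᵈ`. -/
def embed (hd : K ≤ d) : Matrix (Fin d) (Fin K) ℝ :=
  Matrix.of fun i k => if i = Fin.castLE hd k then 1 else 0

theorem embed_isometry (hd : K ≤ d) : (embed hd)ᵀ * embed hd = 1 := by
  ext k l
  simp [embed, Matrix.mul_apply, Matrix.one_apply, eq_comm]

/-- The balanced parameters whose layers are all scaled copies of `T`. -/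
noncomputable def powerParams (n m : ℕ) (hd : K ≤ d) (T : Matrix (Fin K) (Fin K) ℝ) (a : ℝ) :
    Params K d n m :=
  (a • (1 * T * (embed hd)ᵀ), fun _ => a • (embed hd * T * (embed hd)ᵀ),
    a • (embed hd * T * ((Real.sqrt n)⁻¹ • (replicateCols K n)ᵀ)ᵀ))

theorem logits_powerParams (hn : 1 ≤ n) (hd : K ≤ d) (T : Matrix (Fin K) (Fin K) ℝ) {a : ℝ}
    (ha : a ^ (m + 2) = Real.sqrt n) :
    logits (powerParams n m hd T a) = T ^ (m + 2) * replicateCols K n := by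
  have hn' : Real.sqrt n ≠ 0 := by positivity
  have hp : ∀ k : ℕ, (embed hd)ᵀ * (a • (embed hd * T * (embed hd)ᵀ)) ^ k * embed hd
      = a ^ k • T ^ k := by
    intro k
    induction k with
    | zero => simp [embed_isometry]
    | succ k ih =>
      have : (embed hd)ᵀ * (a • (embed hd * T * (embed hd)ᵀ)) ^ (k + 1) * embed hd
          = a • (((embed hd)ᵀ * (a • (embed hd * T * (embed hd)ᵀ)) ^ k * embed hd) * T
            * ((embed hd)ᵀ * embed hd)) := by
        rw [pow_succ]
        simp only [Matrix.mul_assoc, Matrix.mul_smul, Matrix.smul_mul]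
      rw [this, ih, embed_isometry, Matrix.mul_one, Matrix.smul_mul, smul_smul, ← pow_succ,
        ← pow_succ']
  have hl : (powerParams n m hd T a).last = a • (1 * T * (embed hd)ᵀ) := rfl
  have hf : (powerParams n m hd T a).feat
      = a • (embed hd * T * ((Real.sqrt n)⁻¹ • (replicateCols K n)ᵀ)ᵀ) := rfl
  have hh : (powerParams n m hd T a).hidden = fun _ => a • (embed hd * T * (embed hd)ᵀ) := rfl
  rw [logits, hl, hf, hh, List.ofFn_const, List.reverse_replicate, List.prod_replicate]
  calc _ = (a * (Real.sqrt n)⁻¹ * a) • (T * ((embed hd)ᵀ *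
        (a • (embed hd * T * (embed hd)ᵀ)) ^ m * embed hd) * T * replicateCols K n) := by
        simp only [Matrix.one_mul, Matrix.transpose_smul, Matrix.transpose_transpose,
          Matrix.mul_smul, Matrix.smul_mul, Matrix.mul_assoc, mul_smul]
    _ = T ^ (m + 2) * replicateCols K n := by
        rw [hp, Matrix.mul_smul, ← pow_succ', Matrix.smul_mul, ← pow_succ, Matrix.smul_mul,
          smul_smul, show a * (Real.sqrt n)⁻¹ * a * a ^ m = a ^ (m + 2) * (Real.sqrt n)⁻¹ by ring,
          ha, mul_inv_cancel₀ hn', one_smul]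

theorem frob_sq_isometry_conj {p q s : Type*} [Fintype p] [Fintype q] [Fintype s] [DecidableEq s]
    {P : Matrix p s ℝ} {R : Matrix q s ℝ} (T : Matrix s s ℝ) (hP : Pᵀ * P = 1) (hR : Rᵀ * R = 1) :
    frob (P * T * Rᵀ) ^ 2 = frob T ^ 2 := by
  rw [frob_sq_eq_trace, frob_sq_eq_trace]
  rw [show (P * T * Rᵀ)ᵀ * (P * T * Rᵀ) = R * (Tᵀ * (Pᵀ * P) * T * Rᵀ) by
    simp only [Matrix.transpose_mul, Matrix.transpose_transpose, Matrix.mul_assoc], hP,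
    Matrix.trace_mul_comm, Matrix.mul_assoc _ Rᵀ, hR, Matrix.mul_one, Matrix.mul_one]

theorem objective_powerParams (hn : 1 ≤ n) (hd : K ≤ d) (T : Matrix (Fin K) (Fin K) ℝ) (a : ℝ) :
    objective (powerParams n m hd T a) = a ^ 2 * ((m + 2) * frob T ^ 2) := by
  have hn' : (n : ℝ) ≠ 0 := by positivity
  have hl : (powerParams n m hd T a).last = a • (1 * T * (embed hd)ᵀ) := rfl
  have hf : (powerParams n m hd T a).feat
      = a • (embed hd * T * ((Real.sqrt n)⁻¹ • (replicateCols K n)ᵀ)ᵀ) := rfl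
  have hh : (powerParams n m hd T a).hidden = fun _ => a • (embed hd * T * (embed hd)ᵀ) := rfl
  have hB : ((Real.sqrt n)⁻¹ • (replicateCols K n)ᵀ)ᵀ * ((Real.sqrt n)⁻¹ • (replicateCols K n)ᵀ)
      = 1 := by
    rw [Matrix.transpose_smul, Matrix.smul_mul, Matrix.mul_smul, smul_smul,
      inv_sqrt_mul_inv_sqrt, Matrix.transpose_transpose, replicateCols_mul_transpose, smul_smul,
      inv_mul_cancel₀ hn', one_smul]
  rw [objective, hl, hf, hh]
  simp only [frob_smul, mul_pow, sq_abs]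
  rw [frob_sq_isometry_conj T (embed_isometry hd) hB,
    frob_sq_isometry_conj T (embed_isometry hd) (embed_isometry hd),
    frob_sq_isometry_conj T (by simp) (embed_isometry hd)]
  simp
  ring

theorem simplexETF_pow (hK : 1 ≤ K) (k : ℕ) : simplexETF K ^ (k + 1) = simplexETF K := by
  induction k with
  | zero => simp
  | succ k ih => rw [pow_succ, ih, simplexETF_mul_self hK]

theorem frob_sq_simplexETF (hK : 1 ≤ K) : frob (simplexETF K) ^ 2 = ((K - 1 : ℕ) : ℝ) := by
  rw [frob_sq_eq_trace, simplexETF_transpose, simplexETF_mul_self hK, trace_simplexETF hK]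

end construction

/-! ### The antipodal competitor. -/

/-- The rank one matrix `(t / 2) (e₁ - e₂) (e₁ - e₂)ᵀ`. -/
noncomputable def antipodal (t : ℝ) : Matrix (Fin 2) (Fin 2) ℝ :=
  Matrix.of fun i j => if i = j then t / 2 else -(t / 2)

theorem antipodal_mul (s t : ℝ) : antipodal s * antipodal t = antipodal (s * t) := by
  ext i j
  fin_cases i <;> fin_cases j <;> simp [antipodal, Matrix.mul_apply, Fin.sum_univ_two] <;> ring

/-- `q` antipodal pairs of classes and `s` further classes, all mutually orthogonal. -/
noncomputable def pairsMatrix (q s : ℕ) (t : ℝ) :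
    Matrix ((Fin 2 × Fin q) ⊕ Fin s) ((Fin 2 × Fin q) ⊕ Fin s) ℝ :=
  Matrix.fromBlocks (Matrix.blockDiagonal fun _ => antipodal t) 0 0 1

theorem pairsMatrix_mul (q s : ℕ) (t u : ℝ) :
    pairsMatrix q s t * pairsMatrix q s u = pairsMatrix q s (t * u) := by
  simp [pairsMatrix, Matrix.fromBlocks_multiply, ← Matrix.blockDiagonal_mul, antipodal_mul]

theorem pairsMatrix_pow (q s : ℕ) (t : ℝ) (k : ℕ) :
    pairsMatrix q s t ^ (k + 1) = pairsMatrix q s (t ^ (k + 1)) := by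
  induction k with
  | zero => simp
  | succ k ih => rw [pow_succ, ih, pairsMatrix_mul, ← pow_succ]

theorem frob_sq_pairsMatrix (q s : ℕ) (t : ℝ) :
    frob (pairsMatrix q s t) ^ 2 = q * t ^ 2 + s := by
  have hT : (pairsMatrix q s t)ᵀ = pairsMatrix q s t := by
    have : (antipodal t)ᵀ = antipodal t := by ext i j; simp [antipodal, eq_comm]
    simp [pairsMatrix, Matrix.fromBlocks_transpose, Matrix.blockDiagonal_transpose, this]
  rw [frob_sq_eq_trace, hT, pairsMatrix_mul]
  simp [pairsMatrix, antipodal, Matrix.trace, Matrix.blockDiagonal_apply]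
  ring

/-- At parameter 2 the diagonal entries are all 1; off the diagonal the entries are -1 within a pair
and 0 elsewhere. -/
theorem pairsMatrix_margin (q s : ℕ) {c c' : (Fin 2 × Fin q) ⊕ Fin s} (h : c' ≠ c) :
    1 ≤ pairsMatrix q s 2 c c - pairsMatrix q s 2 c' c := by
  rcases c with ⟨x, y⟩ | c <;> rcases c' with ⟨x', y'⟩ | c'
  · simp only [pairsMatrix, Matrix.fromBlocks_apply₁₁, Matrix.blockDiagonal_apply, antipodal,
      Matrix.of_apply, if_true]
    by_cases hy : y' = y
    · have hx : x' ≠ x := fun hx => h (by rw [hx, hy])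
      simp [hy, hx]
    · simp [hy]
  · simp [pairsMatrix, Matrix.blockDiagonal_apply, antipodal]
  · simp [pairsMatrix]
  · have : c' ≠ c := fun hc => h (by rw [hc])
    simp [pairsMatrix, this]

/-- A matrix whose `N`-th power has margins at least one, with smaller Frobenius norm than the
simplex. -/
theorem exists_root_margin {K N : ℕ} (h : (N = 3 ∧ 6 ≤ K) ∨ (4 ≤ N ∧ 4 ≤ K)) :
    ∃ T : Matrix (Fin K) (Fin K) ℝ,
      (∀ c c' : Fin K, c' ≠ c → 1 ≤ (T ^ N) c c - (T ^ N) c' c) ∧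
      frob T ^ 2 < ((K - 1 : ℕ) : ℝ) := by
  -- The last condition on `t` is q t² + s < K - 1 with K = 2q + s, that is, a smaller squared norm
  -- than the simplex.
  have key : ∀ q s : ℕ, K = 2 * q + s → ∀ t : ℝ, t ^ N = 2 → 0 < N → q * t ^ 2 + 1 < 2 * q →
      ∃ T : Matrix (Fin K) (Fin K) ℝ,
      (∀ c c' : Fin K, c' ≠ c → 1 ≤ (T ^ N) c c - (T ^ N) c' c) ∧
      frob T ^ 2 < ((K - 1 : ℕ) : ℝ) := by
    intro q s hK t ht hN hq
    have hq0 : 0 < q := Nat.pos_of_ne_zero fun h0 => by subst h0; norm_num at hq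
    let e : Fin K ≃ (Fin 2 × Fin q) ⊕ Fin s := Fintype.equivOfCardEq (by simp [hK])
    refine ⟨(pairsMatrix q s t).submatrix e e, fun c c' hc => ?_, ?_⟩
    · have hpow : (pairsMatrix q s t).submatrix e e ^ N = (pairsMatrix q s 2).submatrix e e := by
        obtain ⟨k, rfl⟩ := Nat.exists_eq_succ_of_ne_zero hN.ne'
        have h1 := map_pow (Matrix.reindexAlgEquiv ℝ ℝ e.symm) (pairsMatrix q s t) (k + 1)
        rw [pairsMatrix_pow, ht] at h1
        simpa [Matrix.coe_reindexAlgEquiv, Matrix.reindex_apply] using h1.symm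
      rw [hpow]
      exact pairsMatrix_margin q s (fun h => hc (e.injective h))
    · have hf : frob ((pairsMatrix q s t).submatrix e e) ^ 2 = frob (pairsMatrix q s t) ^ 2 := by
        rw [frob_sq, frob_sq]
        simp only [Matrix.submatrix_apply]
        rw [← e.sum_comp]
        exact Finset.sum_congr rfl fun i _ => e.sum_comp fun j => pairsMatrix q s t (e i) j ^ 2
      rw [hf, frob_sq_pairsMatrix, Nat.cast_sub (by omega), hK]
      push_cast
      linarith
  have hN : 0 < N := by omega
  set t : ℝ := 2 ^ (1 / (N : ℝ)) with ht_def
  have ht0 : 0 < t := by positivity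
  have ht : t ^ N = 2 := by
    rw [ht_def, one_div]
    exact Real.rpow_inv_natCast_pow (by norm_num) hN.ne'
  have ht4 : (t ^ 2) ^ N = 4 := by rw [← pow_mul, mul_comm, pow_mul, ht]; norm_num
  rcases h with ⟨rfl, hK⟩ | ⟨hN4, hK⟩
  -- Three pairs need t² < 5/3, which holds as 4 < (5/3)³. Two pairs need t² < 3/2, which fails for
  -- N = 3 but holds for N ≥ 4 as 4 < (3/2)⁴.
  · have h1 : t ^ 2 < 5 / 3 := lt_of_pow_lt_pow_left₀ 3 (by norm_num) (by rw [ht4]; norm_num)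
    refine key 3 (K - 6) (by omega) t ht hN ?_
    push_cast
    linarith
  · have h1 : t ^ 2 < 3 / 2 := by
      refine lt_of_pow_lt_pow_left₀ N (by norm_num) ?_
      rw [ht4]
      calc (4 : ℝ) < (3 / 2) ^ 4 := by norm_num
        _ ≤ (3 / 2) ^ N := pow_le_pow_right₀ (by norm_num) hN4
    refine key 2 (K - 4) (by omega) t ht hN ?_
    push_cast
    linarith

/-! ### Compactness and the global minimizer. -/

section existence

variable {K d n m : ℕ}

theorem continuous_prod_reverse_ofFn {X : Type*} [TopologicalSpace X]
    {W : X → Fin m → Matrix (Fin d) (Fin d) ℝ} (hW : ∀ j, Continuous fun x => W x j) :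
    Continuous fun x => (List.ofFn (W x)).reverse.prod := by
  induction m with
  | zero => simpa using continuous_const
  | succ m ih =>
    simp only [prod_reverse_ofFn_succ]
    exact (hW _).matrix_mul (ih fun j => hW j.castSucc)

theorem continuous_logits : Continuous (logits : Params K d n m → _) := by
  unfold logits
  refine Continuous.matrix_mul (Continuous.matrix_mul continuous_fst
    (continuous_prod_reverse_ofFn fun j => ?_)) (continuous_snd.comp continuous_snd)
  exact (continuous_apply j).comp (continuous_fst.comp continuous_snd)

theorem continuous_frob_sq {p q : Type*} [Fintype p] [Fintype q] :
    Continuous fun A : Matrix p q ℝ => frob A ^ 2 := by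
  simp only [frob_sq]
  exact continuous_finsetSum _ fun i _ => continuous_finsetSum _ fun j _ =>
    (continuous_id.matrix_elem i j).pow 2

theorem continuous_objective : Continuous (objective : Params K d n m → ℝ) := by
  unfold objective
  refine (continuous_frob_sq.comp (continuous_snd.comp continuous_snd)).add
    ((continuous_finsetSum _ fun j _ => continuous_frob_sq.comp
      ((continuous_apply j).comp (continuous_fst.comp continuous_snd))).add
    (continuous_frob_sq.comp continuous_fst))

theorem isClosed_feasible : IsClosed (feasible K d n m) := by
  simp only [feasible, Set.ofPred_forall]
  refine isClosed_iInter fun c => isClosed_iInter fun c' => isClosed_iInter fun i =>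
    isClosed_iInter fun _ => isClosed_le continuous_const ?_
  exact (continuous_logits.matrix_elem _ _).sub (continuous_logits.matrix_elem _ _)

theorem isCompact_frob_sq_le {p q : Type*} [Fintype p] [Fintype q] (B : ℝ) :
    IsCompact {A : Matrix p q ℝ | frob A ^ 2 ≤ B} := by
  have hbox : IsCompact (Set.pi Set.univ fun _ : p => Set.pi Set.univ fun _ : q =>
      Set.Icc (-Real.sqrt B) (Real.sqrt B)) :=
    isCompact_univ_pi fun _ => isCompact_univ_pi fun _ => isCompact_Icc
  refine IsCompact.of_isClosed_subset hbox (isClosed_le continuous_frob_sq continuous_const) ?_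
  intro A hA i _ j _
  have hA' : frob A ^ 2 ≤ B := hA
  rw [frob_sq] at hA'
  refine abs_le.mp (Real.abs_le_sqrt (le_trans ?_ hA'))
  exact (Finset.single_le_sum (f := fun j => A i j ^ 2) (fun j _ => sq_nonneg _)
    (Finset.mem_univ j)).trans (Finset.single_le_sum (f := fun i => ∑ j, A i j ^ 2)
    (fun i _ => Finset.sum_nonneg fun j _ => sq_nonneg _) (Finset.mem_univ i))

theorem isCompact_objective_le (B : ℝ) :
    IsCompact {Θ : Params K d n m | objective Θ ≤ B} := by
  refine IsCompact.of_isClosed_subset ((isCompact_frob_sq_le B).prod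
    ((isCompact_univ_pi fun _ => isCompact_frob_sq_le B).prod (isCompact_frob_sq_le B)))
    (isClosed_le continuous_objective continuous_const) ?_
  intro Θ hΘ
  have h : frob Θ.feat ^ 2 + (∑ j, frob (Θ.hidden j) ^ 2 + frob Θ.last ^ 2) ≤ B := hΘ
  have hs : 0 ≤ ∑ j, frob (Θ.hidden j) ^ 2 := Finset.sum_nonneg fun j _ => sq_nonneg _
  refine ⟨show frob Θ.last ^ 2 ≤ B by nlinarith [sq_nonneg (frob Θ.feat)], fun j _ => ?_,
    show frob Θ.feat ^ 2 ≤ B by nlinarith [sq_nonneg (frob Θ.last)]⟩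
  have hj := Finset.single_le_sum (f := fun j => frob (Θ.hidden j) ^ 2)
    (fun j _ => sq_nonneg _) (Finset.mem_univ j)
  change frob (Θ.hidden j) ^ 2 ≤ B
  nlinarith [sq_nonneg (frob Θ.last), sq_nonneg (frob Θ.feat)]

theorem exists_isMinOn_objective (hne : (feasible K d n m).Nonempty) :
    ∃ Θ₀ ∈ feasible K d n m, IsMinOn objective (feasible K d n m) Θ₀ := by
  obtain ⟨Θ₁, h₁⟩ := hne
  obtain ⟨Θ₀, h₀, hmin⟩ := ((isCompact_objective_le (objective Θ₁)).inter_left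
    isClosed_feasible).exists_isMinOn ⟨Θ₁, h₁, le_refl (objective Θ₁)⟩
    continuous_objective.continuousOn
  refine ⟨Θ₀, h₀.1, fun Θ hΘ => ?_⟩
  by_cases h : objective Θ ≤ objective Θ₁
  · exact hmin ⟨hΘ, h⟩
  · exact (h₀.2 : objective Θ₀ ≤ objective Θ₁).trans (not_le.mp h).le

end existence

/-! ### Assembly. -/

/-- Existence of DNC solutions, their value and logits, their sharpness as local minima and a
better competitor, for `m + 2` layers. -/
theorem dnc_landscape {K d n m : ℕ} (hn : 1 ≤ n) (hd : K ≤ d)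
    (hK : (m = 1 ∧ 6 ≤ K) ∨ (2 ≤ m ∧ 4 ≤ K)) :
    (∃ Θ : Params K d n m, IsDNCSolution Θ) ∧
    (∀ Θ : Params K d n m, IsDNCSolution Θ → logits Θ = simplexLogits K n ∧
      ∀ᶠ Θ' in 𝓝[feasible K d n m] Θ, ¬ IsDNCSolution Θ' → objective Θ < objective Θ') ∧
    ∃ Θ₁ ∈ feasible K d n m, ∀ Θ ∈ feasible K d n m, IsDNC Θ → objective Θ₁ < objective Θ := by
  have hK1 : 1 ≤ K := by omega
  have hr : K - 1 ≤ d := by omega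
  have hr0 : 0 < K - 1 := by omega
  have hr0' : (0 : ℝ) < ((K - 1 : ℕ) : ℝ) := by exact_mod_cast hr0
  have hn' : (0 : ℝ) < n := by positivity
  obtain ⟨U, hU, hUU⟩ := exists_frame hK1
  -- The nonzero singular values of S ⊗ 1ᵀ all equal √n; `a` is the share of each of the m + 2
  -- factors.
  obtain ⟨a, ha, han⟩ : ∃ a : ℝ, 0 < a ∧ a ^ (m + 2) = Real.sqrt n := by
    refine ⟨Real.sqrt n ^ (((m + 2 : ℕ) : ℝ)⁻¹), by positivity, ?_⟩
    exact Real.rpow_inv_natCast_pow (Real.sqrt_nonneg _) (by omega)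
  have han2 : a ^ (2 * (m + 2)) = n := by
    rw [mul_comm, pow_mul, han, Real.sq_sqrt hn'.le]
  have ha2 : 0 < a ^ 2 := by positivity
  set V : ℝ := a ^ 2 * ((m + 2) * ((K - 1 : ℕ) : ℝ)) with hV
  have hcomp : Uᵀ * simplexETF K * U = 1 := by
    rw [← hUU, ← Matrix.mul_assoc, hU, Matrix.one_mul, hU]
  have hmeanS : classMeans (simplexLogits K n) = simplexETF K := by
    rw [simplexLogits_eq, classMeans_mul_replicateCols hn]
  -- any feasible DNC configuration has objective at least `V`
  have hlower : ∀ Θ ∈ feasible K d n m, IsDNC Θ →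
      V ≤ objective Θ ∧ (objective Θ ≤ V → logits Θ = simplexLogits K n) := by
    intro Θ hΘ hdnc
    obtain ⟨τ, hτ⟩ := hdnc.exists_logits_eq
    have hτ1 := one_le_of_feasible (by omega) hn hΘ hτ
    have hdet : (Uᵀ * classMeans (logits Θ) * U).det = τ ^ (K - 1) := by
      rw [hτ, classMeans_smul, hmeanS, Matrix.mul_smul, Matrix.smul_mul, hcomp,
        Matrix.det_smul]
      simp
    have hb := (log_det_classMeans_le_objective hr hn Θ hU
      (by rw [hdet]; positivity) ha han2).1
    rw [hdet, mul_add] at hb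
    have hlog : 0 ≤ Real.log ((τ ^ (K - 1)) ^ 2) :=
      Real.log_nonneg (one_le_pow₀ (one_le_pow₀ hτ1))
    refine ⟨by nlinarith, fun hle => ?_⟩
    rcases hτ1.eq_or_lt with h1 | h1
    · rw [hτ, ← h1, one_smul]
    · have : 0 < Real.log ((τ ^ (K - 1)) ^ 2) :=
        Real.log_pos (one_lt_pow₀ (one_lt_pow₀ h1 hr0.ne') two_ne_zero)
      nlinarith
  have hlog1 : ∀ x : ℝ, 1 ≤ x → 0 ≤ Real.log (x ^ 2) := fun x hx =>
    Real.log_nonneg (one_le_pow₀ hx)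
  -- logits equal to the simplex with objective at most `V` force neural collapse
  have hconstr : ∀ Θ : Params K d n m, logits Θ = simplexLogits K n → objective Θ ≤ V →
      IsDNC Θ := by
    intro Θ hZ hle
    have hdet : (Uᵀ * classMeans (logits Θ) * U).det = 1 := by
      rw [hZ, hmeanS, hcomp, Matrix.det_one]
    have hb := (log_det_classMeans_le_objective hr hn Θ hU (by rw [hdet]; norm_num) ha han2).2
    rw [hdet] at hb
    obtain ⟨Q, hQ⟩ := hb (by simpa [hV] using hle)
    exact hQ.isDNC ha hr0 hZ
  obtain ⟨Θs, hZs, hVs⟩ : ∃ Θs : Params K d n m, logits Θs = simplexLogits K n ∧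
      objective Θs = V := by
    refine ⟨powerParams n m hd (simplexETF K) a, ?_, ?_⟩
    · rw [logits_powerParams hn hd _ han, simplexETF_pow hK1 (m + 1), simplexLogits_eq]
    · rw [objective_powerParams hn, frob_sq_simplexETF hK1]
  have hfs := feasible_of_logits_eq Θs hZs
  have hds := hconstr Θs hZs hVs.le
  -- The least DNC value is V: `hlower` bounds it below and `Θs` attains it.
  have hsol : ∀ Θ : Params K d n m, IsDNCSolution Θ ↔
      Θ ∈ feasible K d n m ∧ IsDNC Θ ∧ objective Θ ≤ V := by
    intro Θ
    constructor
    · rintro ⟨⟨h1, h2⟩, h3⟩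
      exact ⟨h1, h2, hVs ▸ h3 Θs hfs hds⟩
    · rintro ⟨h1, h2, h3⟩
      exact ⟨⟨h1, h2⟩, fun Θ' h4 h5 => h3.trans (hlower Θ' h4 h5).1⟩
  refine ⟨⟨Θs, (hsol Θs).mpr ⟨hfs, hds, hVs.le⟩⟩, fun Θ hΘ => ?_, ?_⟩
  · obtain ⟨h1, h2, h3⟩ := (hsol Θ).mp hΘ
    have hZ := (hlower Θ h1 h2).2 h3
    refine ⟨hZ, ?_⟩
    have htend : Filter.Tendsto (fun Θ' : Params K d n m => classMeans (logits Θ'))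
        (𝓝[feasible K d n m] Θ) (𝓝 (simplexETF K)) := by
      rw [← hmeanS, ← hZ]
      exact ((continuous_classMeans.comp continuous_logits).tendsto Θ).mono_left
        nhdsWithin_le_nhds
    filter_upwards [htend.eventually (eventually_one_le_det hK1 hU hUU), self_mem_nhdsWithin]
      with Θ' hloc hfeas hnot
    -- By contraposition: a nearby feasible point of value at most V has determinant 1, hence tight
    -- margins and aligned layers, so it is a DNC solution.
    refine h3.trans_lt (not_le.mp fun hle => hnot ((hsol Θ').mpr ⟨hfeas, ?_, hle⟩))
    obtain ⟨hdet1, htight⟩ := hloc (classMeans_margin hn hfeas)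
    have hb := log_det_classMeans_le_objective hr hn Θ' hU
      (by linarith : (0 : ℝ) < _).ne' ha han2
    have hdet : (Uᵀ * classMeans (logits Θ') * U).det ≤ 1 := by
      by_contra hgt
      have hpos : 0 < Real.log ((Uᵀ * classMeans (logits Θ') * U).det ^ 2) :=
        Real.log_pos (one_lt_pow₀ (not_le.mp hgt) two_ne_zero)
      have := hb.1
      rw [mul_add] at this
      nlinarith
    have hnn := hlog1 _ hdet1
    obtain ⟨Q, hQ⟩ := hb.2 (by rw [mul_add]; nlinarith)
    exact hQ.isDNC ha hr0 (logits_eq_of_aligned hK1 hUU hQ (htight hdet))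
  · obtain ⟨T, hT, hTlt⟩ := exists_root_margin (K := K) (N := m + 2) (by omega)
    refine ⟨powerParams n m hd T a, fun c c' i hc => ?_, fun Θ h1 h2 => ?_⟩
    · rw [logits_powerParams hn hd _ han, mul_replicateCols_apply, mul_replicateCols_apply]
      exact hT c c' hc
    · refine lt_of_lt_of_le ?_ (hlower Θ h1 h2).1
      rw [objective_powerParams hn, hV]
      gcongr

end DeepUFM

theorem mainTheorem1 (K d n L : ℕ) (hn : 1 ≤ n) (hd : K ≤ d)
    (hLK : (L = 2 ∧ 6 ≤ K) ∨ (3 ≤ L ∧ 4 ≤ K)) :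
    -- DNC solutions exist
    (∃ Θ : DeepUFM.Params K d n (L - 1), DeepUFM.IsDNCSolution Θ) ∧
    -- every DNC solution is a local minimum, strict apart from other DNC solutions
    (∀ Θ : DeepUFM.Params K d n (L - 1), DeepUFM.IsDNCSolution Θ →
      DeepUFM.logits Θ = DeepUFM.simplexLogits K n ∧
      IsLocalMinOn DeepUFM.objective (DeepUFM.feasible K d n (L - 1)) Θ ∧
      ∀ᶠ Θ' in 𝓝[DeepUFM.feasible K d n (L - 1)] Θ,
        ¬ DeepUFM.IsDNCSolution Θ' → DeepUFM.objective Θ < DeepUFM.objective Θ') ∧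
    -- the global minimum is attained, and lies strictly below every feasible DNC configuration
    (∃ Θ₀ ∈ DeepUFM.feasible K d n (L - 1),
      IsMinOn DeepUFM.objective (DeepUFM.feasible K d n (L - 1)) Θ₀ ∧
      ∀ Θ ∈ DeepUFM.feasible K d n (L - 1), DeepUFM.IsDNC Θ →
        DeepUFM.objective Θ₀ < DeepUFM.objective Θ) := by
  have h := DeepUFM.dnc_landscape (m := L - 1) hn hd (by omega)
  obtain ⟨hex, hloc, Θ₁, hf₁, hlt⟩ := h
  refine ⟨hex, fun Θ hΘ => ⟨(hloc Θ hΘ).1, ?_, (hloc Θ hΘ).2⟩, ?_⟩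
  · filter_upwards [(hloc Θ hΘ).2] with Θ' h
    by_cases hs : DeepUFM.IsDNCSolution Θ'
    -- Other DNC solutions nearby are covered by the minimality of `Θ` among feasible DNC
    -- configurations.
    · exact hΘ.2 Θ' hs.1.1 hs.1.2
    · exact (h hs).le
  · obtain ⟨Θ₀, hf₀, hmin⟩ := DeepUFM.exists_isMinOn_objective ⟨Θ₁, hf₁⟩
    exact ⟨Θ₀, hf₀, hmin, fun Θ h1 h2 => (hmin hf₁).trans_lt (hlt Θ h1 h2)⟩
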